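/- Let $\Omega=(\mathbb R/2\pi\mathbb Z)^3$, let $H$ be the space of real, square-integrable, mean-zero, divergence-free vector fields on $\Omega$, and let $|\cdot|$ be the $L^2(\Omega)$ norm. Put $A=-\nabla^2$, so that $e^{\lambda A^{1/2}}$ is the operator with Fourier symbol $e^{\lambda|k|}$, $k\in\mathbb Z^3$. Let $B(u,u)=P[(u\cdot\nabla)u]$, where $P$ is the Leray projector onto divergence-free fields. For $\mu,\sigma>0$ consider the unforced Navier--Stokes equations with exponential dissipation $$\frac{du}{dt}+\mu\,e^{2\sigma A^{1/2}}u+B(u,u)=0,\qquad u(0)=u_0\in H .$$ A solution on $[0,T]$ is a weakly continuous function $u:[0,T]\to H$ such that, for every $k\in\mathbb Z^3\setminus\{0\}$ and $t\in[0,T]$, $$\hat u(k,t)=\hat u_0(k)-\int_0^t\Big(\mu e^{2\sigma|k|}\,\hat u(k,s)+\widehat{B(u,u)}(k,s)\Big)\,ds .$$ **Theorem 3.1.** Let $\mu,\sigma,L,U>0$ and $R\ge 0$. For every $\kappa>3$ and $\delta>0$ there is a number $\Lambda>0$, depending only on $\kappa,\delta$ and on $\mu,\sigma,L,U,R$, such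 that the following holds. If $0<T<L/U$, $u_0\in H$ with $|u_0|\le R$, and $u$ is a solution on $[0,T]$ with initial value $u_0$, then for all integers $n\ge 0$ and all $t\in(0,T]$, $$\left|e^{n\sigma A^{1/2}}u(t)\right|^2\le\left(\frac{\Lambda L}{Ut}\right)^{a_n} \qquad\text{and}\qquad \int_t^T\left|e^{(n+1)\sigma A^{1/2}}u(s)\right|^2ds\le\left(\frac{\Lambda L}{Ut}\right)^{a_n},$$ where $$a_n=\left((1+\delta)\,\frac{4\kappa-5}{2\kappa-5}\right)^n .$$ In particular the left-hand sides are finite. -/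

import Mathlib

open MeasureTheory

namespace ExpNSE

noncomputable section

/-- The side length `2π` of the periodic box is positive (Mathlib asks for this fact before it puts
a measure on the circle `ℝ / 2πℤ`). -/
instance factTwoPiPos : Fact (0 < 2 * Real.pi) := ⟨Real.two_pi_pos⟩

/-- The periodic box `Ω = [0,2π]³`, i.e. `(ℝ / 2πℤ)³`. Its `volume` is the product of the
Lebesgue measures of total mass `2π`. -/
abbrev Box : Type := Fin 3 → AddCircle (2 * Real.pi)

/-- A real vector field on the periodic box. -/
abbrev Field : Type := Box → EuclideanSpace ℝ (Fin 3)

/-- The Fourier coefficient `ĝ(k) = (2π)⁻³ ∫_Ω g(x) e^{-i k·x} dx` of a scalar function `g`, so that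
`g(x) = ∑ₖ ĝ(k) e^{i k·x}`. -/
def scalarCoeff (g : Box → ℝ) (k : Fin 3 → ℤ) : ℂ :=
  (((2 * Real.pi) ^ 3 : ℝ) : ℂ)⁻¹ * ∫ x : Box, (∏ j, fourier (-(k j)) (x j)) * (g x : ℂ)

/-- The `i`-th component of the Fourier coefficient `φ̂(k) ∈ ℂ³` of a vector field `φ`. -/
def coeff (φ : Field) (k : Fin 3 → ℤ) (i : Fin 3) : ℂ :=
  scalarCoeff (fun x => φ x i) k

/-- `|k|²` for a wave vector `k ∈ ℤ³`. -/
def waveSq (k : Fin 3 → ℤ) : ℝ := ∑ j, (k j : ℝ) ^ 2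

/-- The Euclidean length `|k|` of a wave vector, which is the Fourier symbol of `A^{1/2}`, where
`A = -∇²`. -/
def waveNorm (k : Fin 3 → ℤ) : ℝ := Real.sqrt (waveSq k)

/-- Membership in `H`: square integrable, mean zero and (in the sense of distributions)
divergence-free periodic vector fields. -/
structure MemH (φ : Field) : Prop where
  memLp : MemLp φ 2 volume
  mean_zero : ∫ x, φ x = 0
  div_free : ∀ k : Fin 3 → ℤ, ∑ j, (k j : ℂ) * coeff φ k j = 0

/-- The square of the `L²` norm `|e^{λ A^{1/2}} φ|`, where `e^{λ A^{1/2}}` is the operator with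
Fourier symbol `e^{λ|k|}`: by Parseval it is `(2π)³ ∑ₖ e^{2λ|k|} |φ̂(k)|²`. The value is `∞` exactly
when `φ` is outside the domain of `e^{λ A^{1/2}}`. -/
def expNormSq (lam : ℝ) (φ : Field) : ENNReal :=
  ENNReal.ofReal ((2 * Real.pi) ^ 3) *
    ∑' k : Fin 3 → ℤ, ENNReal.ofReal (Real.exp (2 * lam * waveNorm k) * ∑ i, ‖coeff φ k i‖ ^ 2)

/-- The `i`-th component of the `k`-th Fourier coefficient (`k ≠ 0`) of
`B(φ,φ) = P[(φ·∇)φ] = P[∇·(φ ⊗ φ)]`, `φ ∈ H`, where `P` is the Leray projector, whose symbol is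
`δᵢₘ - kᵢ kₘ / |k|²`; the projection eliminates the pressure. The products `φⱼ φₘ` are integrable
because `φ` is square integrable. -/
def nonlinCoeff (φ : Field) (k : Fin 3 → ℤ) (i : Fin 3) : ℂ :=
  ∑ m, (((if i = m then 1 else 0) - (k i : ℝ) * (k m : ℝ) / waveSq k : ℝ) : ℂ) *
    ∑ j, Complex.I * (k j : ℂ) * scalarCoeff (fun x => φ x j * φ x m) k

/-- `u` is a solution on `[0,T]` of the unforced equation
`du/dt + μ e^{2σ A^{1/2}} u + B(u,u) = 0`, `u(0) = u₀`: a weakly continuous function of time with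
values in `H` (its Fourier coefficients are continuous and its `L²` norm is bounded) which satisfies
the equation tested against every mode `e^{i k·x}` and integrated in time. Nothing is required
of the exponentially weighted norms of `u`. -/
structure IsSolution (μ σ T : ℝ) (u₀ : Field) (u : ℝ → Field) : Prop where
  memH : ∀ t ∈ Set.Icc 0 T, MemH (u t)
  bounded : ∃ M : ℝ, ∀ t ∈ Set.Icc 0 T, eLpNorm (u t) 2 volume ≤ ENNReal.ofReal M
  continuous_coeff : ∀ k i, ContinuousOn (fun t => coeff (u t) k i) (Set.Icc 0 T)
  initial : u 0 =ᵐ[volume] u₀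
  equation : ∀ k : Fin 3 → ℤ, k ≠ 0 → ∀ i, ∀ t ∈ Set.Icc 0 T,
    coeff (u t) k i = coeff u₀ k i -
      ∫ s in (0 : ℝ)..t,
        ((μ * Real.exp (2 * σ * waveNorm k) : ℝ) * coeff (u s) k i + nonlinCoeff (u s) k i)

/-- The exponents `a_n = ((1+δ) (4κ-5)/(2κ-5))^n`. -/
def expo (κ δ : ℝ) (n : ℕ) : ℝ := ((1 + δ) * ((4 * κ - 5) / (2 * κ - 5))) ^ n

end

end ExpNSE

/-! Everything happens on the Fourier side. Each coefficient solves `a' + d a + N = 0` with `d = μ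
e^{2σ|k|}`, so by Duhamel it is at most its exponentially damped initial value plus `sup ‖N‖ / d`.

Suppose that `∑ e^{2λ|k|} |a(k)|² ≤ Y` on `[s,t]`. As `e^{λ|k|}` is submultiplicative, the
convolution gives `‖N(k)‖ ≤ 18 |k| e^{-λ|k|} Y`. Division by `d` leaves a summable factor `|k|²
e^{-2σ|k|}` even after `λ` is raised to `λ + σ`, while `e^{-2d(t-s)} ≤ 1/(2d(t-s))` pays for the
same gain in the linear part. Hence one level of regularity costs `Y ↦ Y/(μ(t-s)) + D Y²`
(`hasExpBound_add`).

Iterating with `s = t/2` roughly squares the bound at each level, so exponents `c^n` with any `c >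
2` absorb the constants (`exists_hasExpBound`). The base of `a_n` exceeds 2. The iteration gives
level `n + 1` pointwise in time with exponent `a_n`, which yields level `n` and, integrated over an
interval shorter than `L/U`, the integral bound.

For `Λ` to depend on the data only through `R`, the iteration must start from the energy inequality
(`hasExpBound_zero`), which is not part of the notion of solution. It is proved from the decay in
`k` that the damping provides. -/

namespace ExpNSE

noncomputable section

-- Fourier series on the box, transported from the unit torus.

attribute [local instance] instMeasureSpaceUnitAddCircle
attribute [local instance] instIsAddHaarMeasureUnitAddCircleVolume
attribute [local instance] instIsProbabilityMeasureUnitAddCircleVolume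

/-- Rescaling of the unit torus onto the periodic box. -/
def scaleHom : UnitAddTorus (Fin 3) →+ Box where
  toFun y j := AddCircle.equivAddCircle 1 (2 * Real.pi) one_ne_zero Real.two_pi_pos.ne' (y j)
  map_zero' := by ext j; simp
  map_add' x y := by ext j; simp

theorem continuous_scaleHom : Continuous scaleHom :=
  continuous_pi fun j =>
    (AddCircle.homeomorphAddCircle 1 (2 * Real.pi) one_ne_zero
      Real.two_pi_pos.ne').continuous.comp (continuous_apply j)

theorem surjective_scaleHom : Function.Surjective scaleHom := fun x =>
  ⟨fun j => (AddCircle.equivAddCircle 1 (2 * Real.pi) one_ne_zero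
    Real.two_pi_pos.ne').symm (x j), by ext j; simp [scaleHom]⟩

theorem fourier_equivAddCircle (n : ℤ) (y : UnitAddCircle) :
    fourier n (AddCircle.equivAddCircle 1 (2 * Real.pi) one_ne_zero Real.two_pi_pos.ne' y)
      = fourier n y := by
  induction y using QuotientAddGroup.induction_on with
  | H y =>
    have := AddCircle.equivAddCircle_apply_mk (1:ℝ) (2 * Real.pi) one_ne_zero Real.two_pi_pos.ne' y
    rw [this, fourier_coe_apply, fourier_coe_apply]
    congr 1
    have : (Real.pi : ℂ) ≠ 0 := by exact_mod_cast Real.pi_ne_zero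
    push_cast
    field_simp

theorem prod_fourier_scaleHom (k : Fin 3 → ℤ) (y : UnitAddTorus (Fin 3)) :
    ∏ j, fourier (k j) (scaleHom y j) = UnitAddTorus.mFourier k y :=
  Finset.prod_congr rfl fun j _ => fourier_equivAddCircle (k j) (y j)

theorem volume_box_univ :
    (volume : Measure Box) Set.univ = ENNReal.ofReal ((2 * Real.pi) ^ 3) := by
  rw [volume_pi, Measure.pi_univ]
  simp only [AddCircle.measure_univ, Finset.prod_const, Finset.card_univ, Fintype.card_fin]
  rw [ENNReal.ofReal_pow Real.two_pi_pos.le]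

instance isFiniteMeasure_box : IsFiniteMeasure (volume : Measure Box) :=
  ⟨by rw [volume_box_univ]; exact ENNReal.ofReal_lt_top⟩

/-- Uniqueness of Haar measure: a continuous surjective homomorphism of compact groups preserves
Haar measures of equal total mass. -/
theorem measurePreserving_scaleHom :
    MeasurePreserving scaleHom volume
      ((ENNReal.ofReal ((2 * Real.pi) ^ 3))⁻¹ • (volume : Measure Box)) := by
  have h0 : ENNReal.ofReal ((2 * Real.pi) ^ 3) ≠ 0 := by
    rw [Ne, ENNReal.ofReal_eq_zero, not_le]; positivity
  have : Measure.IsAddHaarMeasure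
      ((ENNReal.ofReal ((2 * Real.pi) ^ 3))⁻¹ • (volume : Measure Box)) :=
    Measure.IsAddHaarMeasure.smul _ (ENNReal.inv_ne_zero.2 ENNReal.ofReal_ne_top)
      (ENNReal.inv_ne_top.2 h0)
  refine AddMonoidHom.measurePreserving continuous_scaleHom surjective_scaleHom ?_
  rw [measure_univ, Measure.smul_apply, volume_box_univ, smul_eq_mul,
    ENNReal.inv_mul_cancel h0 ENNReal.ofReal_ne_top]

theorem measurableEmbedding_scaleHom : MeasurableEmbedding scaleHom := by
  refine continuous_scaleHom.measurableEmbedding ?_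
  intro x y h
  funext j
  exact (AddCircle.equivAddCircle 1 (2 * Real.pi) one_ne_zero Real.two_pi_pos.ne').injective
    (congrFun h j)

theorem integral_scaleHom {E : Type*} [NormedAddCommGroup E] [NormedSpace ℝ E] (f : Box → E) :
    ∫ y, f (scaleHom y) = ((2 * Real.pi) ^ 3)⁻¹ • ∫ x, f x := by
  rw [measurePreserving_scaleHom.integral_comp measurableEmbedding_scaleHom,
    integral_smul_measure, ENNReal.toReal_inv, ENNReal.toReal_ofReal (by positivity)]

theorem scalarCoeff_eq_mFourierCoeff (g : Box → ℝ) (k : Fin 3 → ℤ) :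
    scalarCoeff g k = UnitAddTorus.mFourierCoeff (fun y => (g (scaleHom y) : ℂ)) k := by
  have := integral_scaleHom fun x : Box => (∏ j, fourier (-(k j)) (x j)) * (g x : ℂ)
  rw [scalarCoeff, UnitAddTorus.mFourierCoeff, ← Complex.ofReal_inv, ← Complex.real_smul, ← this]
  refine integral_congr_ae (Filter.Eventually.of_forall fun y => ?_)
  simp only [smul_eq_mul]
  rw [← prod_fourier_scaleHom]
  rfl

theorem MemLp.comp_scaleHom {g : Box → ℝ} (hg : MemLp g 2 volume) :
    MemLp (fun y => (g (scaleHom y) : ℂ)) 2 volume := by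
  have h0 : ENNReal.ofReal ((2 * Real.pi) ^ 3) ≠ 0 := by
    rw [Ne, ENNReal.ofReal_eq_zero, not_le]; positivity
  exact ((hg.smul_measure (ENNReal.inv_ne_top.2 h0)).comp_measurePreserving
    measurePreserving_scaleHom).ofReal

theorem scalarCoeff_neg (g : Box → ℝ) (k : Fin 3 → ℤ) :
    scalarCoeff g (-k) = starRingEnd ℂ (scalarCoeff g k) := by
  simp only [scalarCoeff_eq_mFourierCoeff, UnitAddTorus.mFourierCoeff, ← integral_conj]
  refine integral_congr_ae (Filter.Eventually.of_forall fun y => ?_)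
  simp only [smul_eq_mul, map_mul, Complex.conj_ofReal]
  rw [UnitAddTorus.mFourier_neg (n := -k)]

/-- Parseval's identity on the periodic box. -/
theorem hasSum_sq_scalarCoeff {g : Box → ℝ} (hg : MemLp g 2 volume) :
    HasSum (fun k => ‖scalarCoeff g k‖ ^ 2) (((2 * Real.pi) ^ 3)⁻¹ * ∫ x, g x ^ 2) := by
  have hG := MemLp.comp_scaleHom hg
  have h := UnitAddTorus.hasSum_sq_mFourierCoeff hG.toLp
  have h1 : ∀ k, UnitAddTorus.mFourierCoeff hG.toLp k = scalarCoeff g k := fun k => by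
    rw [scalarCoeff_eq_mFourierCoeff]
    refine integral_congr_ae ?_
    filter_upwards [hG.coeFn_toLp] with y hy
    rw [hy]
  have h2 : ∫ t, ‖hG.toLp _ t‖ ^ 2 = ((2 * Real.pi) ^ 3)⁻¹ * ∫ x, g x ^ 2 := by
    refine Eq.trans ?_ (integral_scaleHom fun x => g x ^ 2)
    refine integral_congr_ae ?_
    filter_upwards [hG.coeFn_toLp] with y hy
    rw [hy, Complex.norm_real, Real.norm_eq_abs, sq_abs]
  simpa only [h1, h2] using h

/-- The Fourier coefficients of a product of square integrable functions are the convolution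
of the Fourier coefficients of its factors. -/
theorem hasSum_scalarCoeff_mul {g f : Box → ℝ} (hg : MemLp g 2 volume) (hh : MemLp f 2 volume)
    (k : Fin 3 → ℤ) :
    HasSum (fun l => scalarCoeff g (k - l) * scalarCoeff f l)
      (scalarCoeff (fun x => g x * f x) k) := by
  have hG := MemLp.comp_scaleHom hg
  have hH := MemLp.comp_scaleHom hh
  -- Parseval is applied to the pair `e_k g`, `f`. As `g` is real, the conjugate of the `l`-th
  -- coefficient of `e_k g` is the coefficient of `g` at `k - l`.
  have hF : MemLp (fun y => UnitAddTorus.mFourier k y * (g (scaleHom y) : ℂ)) 2 volume := by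
    refine MemLp.mul (p := ⊤) (q := 2) (r := 2) hG ?_
    refine memLp_top_of_bound (UnitAddTorus.mFourier k).continuous.aestronglyMeasurable 1 ?_
    refine Filter.Eventually.of_forall fun y => ?_
    exact ((UnitAddTorus.mFourier k).norm_coe_le_norm y).trans UnitAddTorus.mFourier_norm.le
  have h := UnitAddTorus.hasSum_prod_mFourierCoeff hF.toLp hH.toLp
  have h1 : ∀ l, starRingEnd ℂ (UnitAddTorus.mFourierCoeff hF.toLp l)
      = scalarCoeff g (k - l) := fun l => by
    rw [scalarCoeff_eq_mFourierCoeff, UnitAddTorus.mFourierCoeff, UnitAddTorus.mFourierCoeff,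
      ← integral_conj]
    refine integral_congr_ae ?_
    filter_upwards [hF.coeFn_toLp] with y hy
    rw [hy, smul_eq_mul, smul_eq_mul, ← mul_assoc, ← UnitAddTorus.mFourier_add, map_mul,
      ← UnitAddTorus.mFourier_neg, Complex.conj_ofReal]
    congr 3
    abel
  have h2 : ∀ l, UnitAddTorus.mFourierCoeff hH.toLp l = scalarCoeff f l := fun l => by
    rw [scalarCoeff_eq_mFourierCoeff]
    refine integral_congr_ae ?_
    filter_upwards [hH.coeFn_toLp] with y hy
    rw [hy]
  have h3 : ∫ t, starRingEnd ℂ (hF.toLp _ t) * hH.toLp _ t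
      = scalarCoeff (fun x => g x * f x) k := by
    rw [scalarCoeff_eq_mFourierCoeff, UnitAddTorus.mFourierCoeff]
    refine integral_congr_ae ?_
    filter_upwards [hF.coeFn_toLp, hH.coeFn_toLp] with y hy hy'
    rw [hy, hy', map_mul, ← UnitAddTorus.mFourier_neg, Complex.conj_ofReal, smul_eq_mul]
    push_cast
    ring
  simpa only [h1, h2, h3] using h

/-! ### Wave vectors and lattice sums. -/

theorem waveNorm_nonneg (k : Fin 3 → ℤ) : 0 ≤ waveNorm k := Real.sqrt_nonneg _

theorem waveSq_eq_waveNorm_sq (k : Fin 3 → ℤ) : waveSq k = waveNorm k ^ 2 :=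
  (Real.sq_sqrt (Finset.sum_nonneg fun _ _ => sq_nonneg _)).symm

theorem abs_le_waveNorm (k : Fin 3 → ℤ) (j : Fin 3) : |(k j : ℝ)| ≤ waveNorm k := by
  refine Real.abs_le_sqrt ?_
  exact Finset.single_le_sum (f := fun j => (k j : ℝ) ^ 2) (fun _ _ => sq_nonneg _)
    (Finset.mem_univ j)

theorem waveNorm_eq_norm (k : Fin 3 → ℤ) :
    waveNorm k = ‖(WithLp.toLp 2 fun j => (k j : ℝ) : EuclideanSpace ℝ (Fin 3))‖ := by
  simp [waveNorm, waveSq, EuclideanSpace.norm_eq]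

theorem waveNorm_le_sub_add (k l : Fin 3 → ℤ) :
    waveNorm k ≤ waveNorm (k - l) + waveNorm l := by
  simp only [waveNorm_eq_norm]
  refine le_trans (le_of_eq ?_) (norm_add_le _ _)
  congr 1
  ext j
  simp

theorem summable_prod_apply {ι : Type*} {f : ι → ℝ} (hf : Summable f) (h0 : ∀ n, 0 ≤ f n)
    (d : ℕ) : Summable fun k : Fin d → ι => ∏ j, f (k j) := by
  induction d with
  | zero => exact (hasSum_fintype _).summable
  | succ d ih =>
    rw [← (Fin.consEquiv fun _ : Fin (d + 1) => ι).summable_iff]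
    have := hf.mul_of_nonneg ih h0 fun k => Finset.prod_nonneg fun j _ => h0 _
    refine this.congr fun p => ?_
    simp [Fin.consEquiv, Fin.prod_univ_succ]

theorem summable_exp_neg_mul_abs {c : ℝ} (hc : 0 < c) :
    Summable fun n : ℤ => Real.exp (-c * |(n : ℝ)|) := by
  have : Summable fun n : ℕ => Real.exp (-c * (n : ℝ)) := by
    refine (Real.summable_exp_nat_mul_iff.2 (neg_lt_zero.2 hc)).congr fun n => ?_
    rw [mul_comm]
  refine Summable.of_nat_of_neg ?_ ?_ <;> simpa using this

/-- Since `|k| ≥ (|k₀| + |k₁| + |k₂|)/3`, a product of three geometric series is a majorant. -/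
theorem summable_exp_neg_mul_waveNorm {c : ℝ} (hc : 0 < c) :
    Summable fun k : Fin 3 → ℤ => Real.exp (-c * waveNorm k) := by
  refine Summable.of_nonneg_of_le (fun _ => (Real.exp_pos _).le) (fun k => ?_)
    (summable_prod_apply (summable_exp_neg_mul_abs (c := c / 3) (by positivity))
      (fun _ => (Real.exp_pos _).le) 3)
  rw [← Real.exp_sum]
  refine Real.exp_le_exp.2 ?_
  rw [← Finset.mul_sum]
  have := Finset.sum_le_sum fun j (_ : j ∈ Finset.univ) => abs_le_waveNorm k j
  simp only [Finset.sum_const, Finset.card_univ, Fintype.card_fin, nsmul_eq_mul] at this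
  push_cast at this
  nlinarith

/-- Half of the exponential absorbs the power, by `x^p / p! ≤ e^x`. -/
theorem summable_waveNorm_pow_mul_exp {c : ℝ} (hc : 0 < c) (p : ℕ) :
    Summable fun k : Fin 3 → ℤ => waveNorm k ^ p * Real.exp (-c * waveNorm k) := by
  refine Summable.of_nonneg_of_le
    (fun k => mul_nonneg (pow_nonneg (waveNorm_nonneg k) _) (Real.exp_pos _).le) (fun k => ?_)
    ((summable_exp_neg_mul_waveNorm (half_pos hc)).mul_left (p.factorial * (2 / c) ^ p))
  have h := Real.pow_div_factorial_le_exp (c / 2 * waveNorm k)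
    (mul_nonneg (half_pos hc).le (waveNorm_nonneg k)) p
  have h1 : waveNorm k ^ p ≤ p.factorial * (2 / c) ^ p * Real.exp (c / 2 * waveNorm k) := by
    rw [mul_pow, div_le_iff₀ (by positivity)] at h
    have h2 : (2 / c) ^ p * (c / 2) ^ p = 1 := by
      rw [← mul_pow]; field_simp; simp
    calc waveNorm k ^ p = (2 / c) ^ p * ((c / 2) ^ p * waveNorm k ^ p) := by
          rw [← mul_assoc, h2, one_mul]
      _ ≤ (2 / c) ^ p * (Real.exp (c / 2 * waveNorm k) * p.factorial) := by gcongr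
      _ = _ := by ring
  calc _ ≤ p.factorial * (2 / c) ^ p * Real.exp (c / 2 * waveNorm k)
        * Real.exp (-c * waveNorm k) := by gcongr
    _ = _ := by rw [mul_assoc, ← Real.exp_add]; congr 2; ring

/-! ### Integrated linear equations for a single mode. -/

/-- The product rule for absolutely continuous functions, in integrated form. -/
theorem integral_deriv_mul_add {f g F G : ℝ → ℝ} {s t : ℝ} (hst : s ≤ t)
    (hf : IntervalIntegrable f volume s t) (hg : IntervalIntegrable g volume s t)
    (hF : ∀ r ∈ Set.Icc s t, F r = F s + ∫ x in s..r, f x)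
    (hG : ∀ r ∈ Set.Icc s t, G r = G s + ∫ x in s..r, g x) :
    ∫ x in s..t, (f x * G x + F x * g x) = F t * G t - F s * G s := by
  -- `F` and `G` are controlled only on `[s,t]`, so the product rule is applied to the primitives
  -- that agree with them there.
  have key : ∀ {h H : ℝ → ℝ}, IntervalIntegrable h volume s t →
      AbsolutelyContinuousOnInterval (fun r => H s + ∫ x in s..r, h x) s t := fun {h H} hh => by
    have h1 : AbsolutelyContinuousOnInterval (fun _ : ℝ => H s) s t :=
      (LipschitzWith.const (H s)).lipschitzOnWith.absolutelyContinuousOnInterval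
    exact h1.add (hh.absolutelyContinuousOnInterval_intervalIntegral (by simp))
  have h := (key (H := F) hf).integral_deriv_mul_eq_sub (key (H := G) hg)
  rw [← hF t ⟨hst, le_rfl⟩, ← hG t ⟨hst, le_rfl⟩] at h
  simp only [intervalIntegral.integral_same, add_zero] at h
  rw [← h]
  refine intervalIntegral.integral_congr_ae ?_
  filter_upwards [hf.ae_hasDerivAt_integral, hg.ae_hasDerivAt_integral] with x hx hx' hxI
  have hxu : x ∈ Set.uIcc s t := Set.uIoc_subset_uIcc hxI
  rw [((hx hxu s (by simp)).const_add (F s)).deriv, ((hx' hxu s (by simp)).const_add (G s)).deriv]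
  rw [Set.uIcc_of_le hst] at hxu
  rw [← hF x hxu, ← hG x hxu]

/-- `a` solves `a' + c a + N = 0` on `[0,T]`, in integrated form. -/
structure IsModeSolution (c T : ℝ) (a N : ℝ → ℂ) : Prop where
  continuousOn : ContinuousOn a (Set.Icc 0 T)
  integrable : IntervalIntegrable N volume 0 T
  equation : ∀ t ∈ Set.Icc 0 T, a t = a 0 - ∫ s in (0 : ℝ)..t, ((c : ℂ) * a s + N s)

namespace IsModeSolution

variable {c T : ℝ} {a N : ℝ → ℂ}

theorem intervalIntegrable (h : IsModeSolution c T a N) {s t : ℝ} (hs : 0 ≤ s) (hst : s ≤ t)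
    (ht : t ≤ T) : IntervalIntegrable (fun r => (c : ℂ) * a r + N r) volume s t := by
  have hsub : Set.uIcc s t ⊆ Set.uIcc 0 T := by
    rw [Set.uIcc_of_le hst, Set.uIcc_of_le (hs.trans (hst.trans ht))]
    exact Set.Icc_subset_Icc hs ht
  have h1 : ContinuousOn a (Set.uIcc s t) := by
    refine h.continuousOn.mono ?_
    rw [Set.uIcc_of_le hst]
    exact Set.Icc_subset_Icc hs ht
  exact (h1.intervalIntegrable.const_mul _).add (h.integrable.mono_set hsub)

theorem equation_from (h : IsModeSolution c T a N) {s t : ℝ} (hs : 0 ≤ s) (hst : s ≤ t)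
    (ht : t ≤ T) : a t = a s + ∫ r in s..t, -((c : ℂ) * a r + N r) := by
  rw [h.equation t ⟨hs.trans hst, ht⟩, h.equation s ⟨hs, hst.trans ht⟩,
    intervalIntegral.integral_neg,
    ← intervalIntegral.integral_add_adjacent_intervals
      (h.intervalIntegrable le_rfl hs (hst.trans ht)) (h.intervalIntegrable hs hst ht)]
  ring

/-- A real functional of a mode, in integrated form. -/
theorem equation_re (h : IsModeSolution c T a N) (θ : ℂ) {s t : ℝ} (hs : 0 ≤ s) (hst : s ≤ t)
    (ht : t ≤ T) :
    (θ * a t).re = (θ * a s).re + ∫ r in s..t, -(θ * ((c : ℂ) * a r + N r)).re := by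
  have hi := ((h.intervalIntegrable hs hst ht).const_mul θ).neg
  have h1 : ∫ r in s..t, -(θ * ((c : ℂ) * a r + N r)).re
      = (∫ r in s..t, -(θ * ((c : ℂ) * a r + N r))).re := by
    rw [intervalIntegral.integral_of_le hst, intervalIntegral.integral_of_le hst]
    have := integral_re (𝕜 := ℂ) hi.1
    simpa using this
  rw [h1, h.equation_from hs hst ht, mul_add, Complex.add_re]
  congr 2
  rw [intervalIntegral.integral_neg, intervalIntegral.integral_neg,
    intervalIntegral.integral_const_mul, mul_neg]

theorem intervalIntegrable_re (h : IsModeSolution c T a N) (θ : ℂ) {s t : ℝ} (hs : 0 ≤ s)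
    (hst : s ≤ t) (ht : t ≤ T) :
    IntervalIntegrable (fun r => -(θ * ((c : ℂ) * a r + N r)).re) volume s t := by
  have hi := ((h.intervalIntegrable hs hst ht).const_mul θ)
  exact IntervalIntegrable.neg ⟨hi.1.re, hi.2.re⟩

/-- `‖a‖² = (Re a)² + (Re (i a))²`, and the product rule applies to each of these real functionals,
`θ = 1` and `θ = i`. -/
theorem norm_sq_eq (h : IsModeSolution c T a N) {s t : ℝ} (hs : 0 ≤ s) (hst : s ≤ t)
    (ht : t ≤ T) :
    ‖a t‖ ^ 2 = ‖a s‖ ^ 2 -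
      ∫ r in s..t, 2 * (starRingEnd ℂ (a r) * ((c : ℂ) * a r + N r)).re := by
  have hre := fun θ => integral_deriv_mul_add hst (h.intervalIntegrable_re θ hs hst ht)
    (h.intervalIntegrable_re θ hs hst ht) (F := fun r => (θ * a r).re) (G := fun r => (θ * a r).re)
    (fun r hr => h.equation_re θ hs hr.1 (hr.2.trans ht))
    (fun r hr => h.equation_re θ hs hr.1 (hr.2.trans ht))
  have hc : ContinuousOn a (Set.uIcc s t) := by
    refine h.continuousOn.mono ?_
    rw [Set.uIcc_of_le hst]
    exact Set.Icc_subset_Icc hs ht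
  have hint : ∀ θ : ℂ, IntervalIntegrable (fun r =>
      -(θ * ((c : ℂ) * a r + N r)).re * (θ * a r).re
        + (θ * a r).re * -(θ * ((c : ℂ) * a r + N r)).re) volume s t := fun θ => by
    have hcθ : ContinuousOn (fun r => (θ * a r).re) (Set.uIcc s t) :=
      Complex.continuous_re.comp_continuousOn (continuousOn_const.mul hc)
    exact ((h.intervalIntegrable_re θ hs hst ht).mul_continuousOn hcθ).add
      ((h.intervalIntegrable_re θ hs hst ht).continuousOn_mul hcθ)
  have h1 := hre 1
  have h2 := hre Complex.I
  have h3 : ∫ r in s..t, 2 * (starRingEnd ℂ (a r) * ((c : ℂ) * a r + N r)).re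
      = -((∫ r in s..t, (-((1 : ℂ) * ((c : ℂ) * a r + N r)).re * ((1 : ℂ) * a r).re
        + ((1 : ℂ) * a r).re * -((1 : ℂ) * ((c : ℂ) * a r + N r)).re))
        + ∫ r in s..t, (-(Complex.I * ((c : ℂ) * a r + N r)).re * (Complex.I * a r).re
        + (Complex.I * a r).re * -(Complex.I * ((c : ℂ) * a r + N r)).re)) := by
    rw [← intervalIntegral.integral_add (hint 1) (hint Complex.I),
      ← intervalIntegral.integral_neg]
    refine intervalIntegral.integral_congr fun r _ => ?_
    simp
    ring
  rw [h3, h1, h2, ← Complex.normSq_eq_norm_sq, ← Complex.normSq_eq_norm_sq, Complex.normSq_apply,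
    Complex.normSq_apply]
  simp
  ring

/-- Duhamel's estimate, through the integrating factor `e^{cr}` applied to one real functional `Re
(θ a)`. -/
theorem norm_le (h : IsModeSolution c T a N) (hc : 0 < c) {s t K : ℝ} (hs : 0 ≤ s)
    (hst : s ≤ t) (ht : t ≤ T) (hK : ∀ r ∈ Set.Icc s t, ‖N r‖ ≤ K) :
    ‖a t‖ ≤ Real.exp (-c * (t - s)) * ‖a s‖ + K / c := by
  have hK0 : 0 ≤ K := (norm_nonneg _).trans (hK s ⟨le_rfl, hst⟩)
  -- The phase is frozen at the final time, where it rotates `a t` onto the positive axis.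
  obtain ⟨θ, hθ, hθa⟩ : ∃ θ : ℂ, ‖θ‖ ≤ 1 ∧ (θ * a t).re = ‖a t‖ := by
    by_cases h0 : a t = 0
    · exact ⟨0, by simp, by simp [h0]⟩
    · have hn : ‖a t‖ ≠ 0 := norm_ne_zero_iff.2 h0
      refine ⟨starRingEnd ℂ (a t) / ‖a t‖, ?_, ?_⟩
      · rw [norm_div, RCLike.norm_conj, Complex.norm_real, norm_norm, div_self hn]
      · rw [div_mul_eq_mul_div, mul_comm, Complex.mul_conj, Complex.normSq_eq_norm_sq,
          ← Complex.ofReal_div, Complex.ofReal_re]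
        field_simp
  have hexp : ∀ r, Real.exp (c * r) = Real.exp (c * s) + ∫ x in s..r, c * Real.exp (c * x) := by
    intro r
    rw [intervalIntegral.integral_eq_sub_of_hasDerivAt (f := fun x => Real.exp (c * x))]
    · ring
    · intro x _
      have := ((hasDerivAt_id x).const_mul c).exp
      simpa [mul_comm] using this
    · exact Continuous.intervalIntegrable (by fun_prop) _ _
  have hci : IntervalIntegrable (fun x => c * Real.exp (c * x)) volume s t :=
    Continuous.intervalIntegrable (by fun_prop) _ _
  have hp := integral_deriv_mul_add hst (h.intervalIntegrable_re θ hs hst ht) hci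
    (F := fun r => (θ * a r).re) (G := fun r => Real.exp (c * r))
    (fun r hr => h.equation_re θ hs hr.1 (hr.2.trans ht)) (fun r _ => hexp r)
  have hca : ContinuousOn (fun r => (θ * a r).re) (Set.uIcc s t) := by
    refine Complex.continuous_re.comp_continuousOn (continuousOn_const.mul ?_)
    refine h.continuousOn.mono ?_
    rw [Set.uIcc_of_le hst]
    exact Set.Icc_subset_Icc hs ht
  -- The damping cancels in the derivative of `e^{cr} Re (θ a)`, leaving `-e^{cr} Re (θ N) ≤ K
  -- e^{cr}`.
  have hle : ∫ x in s..t, (-(θ * ((c : ℂ) * a x + N x)).re * Real.exp (c * x)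
      + (θ * a x).re * (c * Real.exp (c * x))) ≤ ∫ x in s..t, K / c * (c * Real.exp (c * x)) := by
    refine intervalIntegral.integral_mono_on hst ?_ (hci.const_mul _) fun x hx => ?_
    · exact ((h.intervalIntegrable_re θ hs hst ht).mul_continuousOn (by fun_prop)).add
        (hci.continuousOn_mul hca)
    · have h1 : -(θ * N x).re ≤ K := by
        refine (neg_le_abs _).trans ((Complex.abs_re_le_norm _).trans ?_)
        rw [norm_mul]
        exact (mul_le_mul hθ (hK x hx) (norm_nonneg _) zero_le_one).trans (one_mul K).le
      have h2 : (θ * ((c : ℂ) * a x + N x)).re = c * (θ * a x).re + (θ * N x).re := by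
        rw [mul_add, Complex.add_re, mul_left_comm, Complex.re_ofReal_mul]
      rw [h2]
      have h3 := mul_le_mul_of_nonneg_right h1 (Real.exp_pos (c * x)).le
      have h4 : K / c * (c * Real.exp (c * x)) = K * Real.exp (c * x) := by field_simp
      rw [h4]
      linarith
  rw [hp, intervalIntegral.integral_const_mul, eq_sub_of_add_eq' (hexp t).symm] at hle
  simp only [hθa] at hle
  have h5 : (θ * a s).re ≤ ‖a s‖ := by
    refine (Complex.re_le_norm _).trans ?_
    rw [norm_mul]
    exact mul_le_of_le_one_left (norm_nonneg _) hθ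
  have hKc : 0 ≤ K / c := by positivity
  have h6 : ‖a t‖ * Real.exp (c * t) ≤
      (Real.exp (-c * (t - s)) * ‖a s‖ + K / c) * Real.exp (c * t) := by
    have h7 : Real.exp (-c * (t - s)) * ‖a s‖ * Real.exp (c * t) = ‖a s‖ * Real.exp (c * s) := by
      rw [mul_right_comm, ← Real.exp_add, mul_comm]
      congr 2
      ring
    rw [add_mul, h7]
    nlinarith [Real.exp_pos (c * s), Real.exp_pos (c * t)]
  exact le_of_mul_le_mul_right h6 (Real.exp_pos _)

end IsModeSolution

/-! ### The nonlinear term on the Fourier side. -/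

/-- Families of Fourier coefficients of real, mean-zero, divergence-free vector fields. -/
structure IsSpectrum (a : (Fin 3 → ℤ) → Fin 3 → ℂ) : Prop where
  conj_symm : ∀ k i, a (-k) i = starRingEnd ℂ (a k i)
  zero : ∀ i, a 0 i = 0
  div_free : ∀ k, ∑ j, (k j : ℂ) * a k j = 0

/-- The squared Euclidean norm of the `k`-th coefficient. -/
def modeSq (a : (Fin 3 → ℤ) → Fin 3 → ℂ) (k : Fin 3 → ℤ) : ℝ := ∑ i, ‖a k i‖ ^ 2

/-- The Fourier coefficients of the product of the `j`-th and the `m`-th component. -/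
def convCoeff (a : (Fin 3 → ℤ) → Fin 3 → ℂ) (j m : Fin 3) (k : Fin 3 → ℤ) : ℂ :=
  ∑' l, a (k - l) j * a l m

/-- The symbol of the Leray projector. -/
def leray (k : Fin 3 → ℤ) (i m : Fin 3) : ℝ :=
  (if i = m then 1 else 0) - (k i : ℝ) * (k m : ℝ) / waveSq k

/-- The nonlinear term of the Navier-Stokes equations in terms of Fourier coefficients. -/
def nonlin (a : (Fin 3 → ℤ) → Fin 3 → ℂ) (k : Fin 3 → ℤ) (i : Fin 3) : ℂ :=
  ∑ m, (leray k i m : ℂ) * ∑ j, Complex.I * (k j : ℂ) * convCoeff a j m k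

/-- The weighted sum `∑ₖ e^{2λ|k|} |a(k)|²` converges and is at most `Y`. -/
structure HasExpBound (lam : ℝ) (a : (Fin 3 → ℤ) → Fin 3 → ℂ) (Y : ℝ) : Prop where
  summable : Summable fun k => Real.exp (2 * lam * waveNorm k) * modeSq a k
  tsum_le : ∑' k, Real.exp (2 * lam * waveNorm k) * modeSq a k ≤ Y

variable {a : (Fin 3 → ℤ) → Fin 3 → ℂ}

theorem modeSq_nonneg (a : (Fin 3 → ℤ) → Fin 3 → ℂ) (k : Fin 3 → ℤ) : 0 ≤ modeSq a k :=
  Finset.sum_nonneg fun _ _ => sq_nonneg _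

theorem norm_sq_le_modeSq (a : (Fin 3 → ℤ) → Fin 3 → ℂ) (k : Fin 3 → ℤ) (i : Fin 3) :
    ‖a k i‖ ^ 2 ≤ modeSq a k :=
  Finset.single_le_sum (f := fun i => ‖a k i‖ ^ 2) (fun _ _ => sq_nonneg _) (Finset.mem_univ i)

theorem weighted_nonneg (lam : ℝ) (a : (Fin 3 → ℤ) → Fin 3 → ℂ) (k : Fin 3 → ℤ) :
    0 ≤ Real.exp (2 * lam * waveNorm k) * modeSq a k :=
  mul_nonneg (Real.exp_pos _).le (modeSq_nonneg a k)

namespace HasExpBound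

variable {lam Y : ℝ}

theorem nonneg (h : HasExpBound lam a Y) : 0 ≤ Y :=
  (tsum_nonneg (weighted_nonneg lam a)).trans h.tsum_le

theorem mono_right (h : HasExpBound lam a Y) {Y' : ℝ} (hY : Y ≤ Y') : HasExpBound lam a Y' :=
  ⟨h.summable, h.tsum_le.trans hY⟩

theorem of_le {lam : ℝ} {g : (Fin 3 → ℤ) → ℝ}
    (hle : ∀ k, Real.exp (2 * lam * waveNorm k) * modeSq a k ≤ g k) {Y : ℝ} (hg : HasSum g Y) :
    HasExpBound lam a Y := by
  have := Summable.of_nonneg_of_le (weighted_nonneg lam a) hle hg.summable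
  exact ⟨this, hasSum_le hle this.hasSum hg⟩

theorem mono_left (h : HasExpBound lam a Y) {lam' : ℝ} (hl : lam' ≤ lam) :
    HasExpBound lam' a Y := by
  refine (of_le (fun k => ?_) h.summable.hasSum).mono_right h.tsum_le
  have := waveNorm_nonneg k
  have := modeSq_nonneg a k
  gcongr

/-- A crude substitute for the square root, by `2x ≤ x² + 1`. It serves only in convergence
arguments, where constants do not matter. -/
theorem norm_le (h : HasExpBound 0 a Y) (k : Fin 3 → ℤ) (i : Fin 3) : ‖a k i‖ ≤ Y + 1 := by
  have h1 := h.summable.le_tsum k fun j _ => weighted_nonneg 0 a j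
  simp only [mul_zero, zero_mul, Real.exp_zero, one_mul] at h1
  have h2 := (norm_sq_le_modeSq a k i).trans h1
  have h3 := h.tsum_le
  simp only [mul_zero, zero_mul, Real.exp_zero, one_mul] at h3
  nlinarith [sq_nonneg (‖a k i‖ - 1), norm_nonneg (a k i)]

/-- By `|k| ≤ |k-l| + |l|` the weight `e^{λ|k|}` is distributed over the two factors. Then `xy ≤ (x²
+ y²)/2` leaves two sums, equal under `l ↦ k - l`. -/
theorem norm_convCoeff_le (h : HasExpBound lam a Y) (hl : 0 ≤ lam) (j m : Fin 3)
    (k : Fin 3 → ℤ) : ‖convCoeff a j m k‖ ≤ Real.exp (-lam * waveNorm k) * Y := by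
  have h1 := h.summable.hasSum
  have h2 := (Equiv.subLeft k).hasSum_iff.2 h1
  have h3 := ((h1.add h2).mul_left (1 / 2)).mul_left (Real.exp (-lam * waveNorm k))
  refine (tsum_of_norm_bounded h3 fun l => ?_).trans ?_
  · have hk : Real.exp (lam * waveNorm k)
        ≤ Real.exp (lam * waveNorm (k - l)) * Real.exp (lam * waveNorm l) := by
      rw [← Real.exp_add, ← mul_add]
      exact Real.exp_le_exp.2 (mul_le_mul_of_nonneg_left (waveNorm_le_sub_add k l) hl)
    have hx : (Real.exp (lam * waveNorm (k - l)) * ‖a (k - l) j‖) ^ 2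
        ≤ Real.exp (2 * lam * waveNorm (k - l)) * modeSq a (k - l) := by
      rw [mul_pow, ← Real.exp_nat_mul]
      refine mul_le_mul (le_of_eq ?_) (norm_sq_le_modeSq a _ j) (sq_nonneg _) (Real.exp_pos _).le
      push_cast; congr 1; ring
    have hy : (Real.exp (lam * waveNorm l) * ‖a l m‖) ^ 2
        ≤ Real.exp (2 * lam * waveNorm l) * modeSq a l := by
      rw [mul_pow, ← Real.exp_nat_mul]
      refine mul_le_mul (le_of_eq ?_) (norm_sq_le_modeSq a _ m) (sq_nonneg _) (Real.exp_pos _).le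
      push_cast; congr 1; ring
    have hone : Real.exp (-lam * waveNorm k) * Real.exp (lam * waveNorm k) = 1 := by
      rw [← Real.exp_add]; simp
    simp only [Function.comp_apply, Equiv.subLeft_apply]
    rw [norm_mul]
    calc ‖a (k - l) j‖ * ‖a l m‖
        = Real.exp (-lam * waveNorm k) * (Real.exp (lam * waveNorm k)
          * (‖a (k - l) j‖ * ‖a l m‖)) := by rw [← mul_assoc, hone, one_mul]
      _ ≤ Real.exp (-lam * waveNorm k) * (Real.exp (lam * waveNorm (k - l))
          * Real.exp (lam * waveNorm l) * (‖a (k - l) j‖ * ‖a l m‖)) := by gcongr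
      _ ≤ _ := by
        refine mul_le_mul_of_nonneg_left ?_ (Real.exp_pos _).le
        nlinarith [sq_nonneg (Real.exp (lam * waveNorm (k - l)) * ‖a (k - l) j‖
          - Real.exp (lam * waveNorm l) * ‖a l m‖)]
  · refine mul_le_mul_of_nonneg_left ?_ (Real.exp_pos _).le
    linarith [h.tsum_le]

end HasExpBound

theorem abs_leray_le (k : Fin 3 → ℤ) (i m : Fin 3) : |leray k i m| ≤ 2 := by
  have h1 : |(k i : ℝ) * (k m : ℝ) / waveSq k| ≤ 1 := by
    rw [abs_div, abs_mul, waveSq_eq_waveNorm_sq, abs_of_nonneg (sq_nonneg (waveNorm k)), sq]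
    exact div_le_one_of_le₀ (mul_le_mul (abs_le_waveNorm k i) (abs_le_waveNorm k m)
      (abs_nonneg _) (waveNorm_nonneg k)) (mul_self_nonneg _)
  have h2 : |(if i = m then (1 : ℝ) else 0)| ≤ 1 := by split_ifs <;> simp
  exact (abs_sub _ _).trans (by linarith)

/-- The constant is `18 = 3 · 2 · 3`: the sum over `m`, the bound on the projector's symbol, the sum
over `j`. -/
theorem HasExpBound.norm_nonlin_le {lam Y : ℝ} (h : HasExpBound lam a Y) (hl : 0 ≤ lam)
    (k : Fin 3 → ℤ) (i : Fin 3) :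
    ‖nonlin a k i‖ ≤ 18 * waveNorm k * (Real.exp (-lam * waveNorm k) * Y) := by
  have hk := waveNorm_nonneg k
  have hY := h.nonneg
  have h1 : ∀ m, ‖∑ j, Complex.I * (k j : ℂ) * convCoeff a j m k‖
      ≤ 3 * (waveNorm k * (Real.exp (-lam * waveNorm k) * Y)) := fun m => by
    refine (norm_sum_le_of_le (f := fun j => Complex.I * (k j : ℂ) * convCoeff a j m k)
      Finset.univ (n := fun _ => waveNorm k * (Real.exp (-lam * waveNorm k) * Y))
      fun j _ => ?_).trans (by simp)
    rw [norm_mul, norm_mul, Complex.norm_I, one_mul]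
    refine mul_le_mul ?_ (h.norm_convCoeff_le hl j m k) (norm_nonneg _) hk
    simpa using abs_le_waveNorm k j
  refine (norm_sum_le_of_le (f := fun m => (leray k i m : ℂ) *
      ∑ j, Complex.I * (k j : ℂ) * convCoeff a j m k) Finset.univ
      (n := fun _ => 2 * (3 * (waveNorm k * (Real.exp (-lam * waveNorm k) * Y))))
      fun m _ => ?_).trans ?_
  · rw [norm_mul, Complex.norm_real, Real.norm_eq_abs]
    exact mul_le_mul (abs_leray_le k i m) (h1 m) (norm_nonneg _) zero_le_two
  · simp only [Finset.sum_const, Finset.card_univ, Fintype.card_fin, nsmul_eq_mul]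
    push_cast
    linarith

/-- The Leray projector is the identity on divergence-free fields. -/
theorem IsSpectrum.sum_conj_mul_leray (ha : IsSpectrum a) (k : Fin 3 → ℤ) (m : Fin 3) :
    ∑ i, starRingEnd ℂ (a k i) * (leray k i m : ℂ) = starRingEnd ℂ (a k m) := by
  have h0 : ∑ i, starRingEnd ℂ (a k i) * (k i : ℂ) = 0 := by
    have := congrArg (starRingEnd ℂ) (ha.div_free k)
    simpa [mul_comm] using this
  have h1 : ∀ i, starRingEnd ℂ (a k i) * (leray k i m : ℂ)
      = (if i = m then starRingEnd ℂ (a k i) else 0)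
        - starRingEnd ℂ (a k i) * (k i : ℂ) * ((k m : ℂ) / (waveSq k : ℂ)) := fun i => by
    unfold leray
    split_ifs <;> push_cast <;> ring
  simp only [h1, Finset.sum_sub_distrib, ← Finset.sum_mul, h0]
  simp

/-- One summand of the trilinear form `(B(u,u),u)`. -/
def trilinearTerm (a : (Fin 3 → ℤ) → Fin 3 → ℂ) (m : Fin 3)
    (p : (Fin 3 → ℤ) × (Fin 3 → ℤ)) : ℂ :=
  starRingEnd ℂ (a p.1 m) * a p.2 m * ∑ j, Complex.I * (p.1 j : ℂ) * a (p.1 - p.2) j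

/-- The difference `k - l` is unchanged by the swap. Incompressibility at `k - l` replaces `l` by
`k` in the last factor, and reality exchanges the two conjugates; only the sign of `-l` survives. -/
theorem IsSpectrum.trilinearTerm_swap (ha : IsSpectrum a) (m : Fin 3) (k l : Fin 3 → ℤ) :
    trilinearTerm a m (-l, -k) = -trilinearTerm a m (k, l) := by
  have h0 : ∑ j, Complex.I * (((-l) j : ℤ) : ℂ) * a (k - l) j
      = -∑ j, Complex.I * (k j : ℂ) * a (k - l) j := by
    have := ha.div_free (k - l)
    rw [eq_neg_iff_add_eq_zero, ← Finset.sum_add_distrib]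
    have h2 : ∑ j, Complex.I * ((((k - l) j : ℤ) : ℂ) * a (k - l) j) = 0 := by
      rw [← Finset.mul_sum, this, mul_zero]
    rw [← h2]
    refine Finset.sum_congr rfl fun j _ => ?_
    simp only [Pi.neg_apply, Pi.sub_apply]
    push_cast
    ring
  have h3 : -l - -k = k - l := by abel
  simp only [trilinearTerm, h3, h0, ha.conj_symm, Complex.conj_conj]
  ring

/-- The energy cancellation `(B(u,u),u) = 0`. -/
theorem IsSpectrum.hasSum_conj_mul_nonlin (ha : IsSpectrum a) {B : ℝ} (hB : ∀ k i, ‖a k i‖ ≤ B)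
    {b : (Fin 3 → ℤ) → ℝ} (hab : ∀ k i, ‖a k i‖ ≤ b k) (hb : Summable b)
    (hkb : Summable fun k => waveNorm k * b k) :
    HasSum (fun k => ∑ i, starRingEnd ℂ (a k i) * nonlin a k i) 0 := by
  have hb0 : ∀ k, 0 ≤ b k := fun k => (norm_nonneg _).trans (hab k 0)
  have hB0 : 0 ≤ B := (norm_nonneg _).trans (hB 0 0)
  -- Absolute convergence over pairs `(k,l)` makes the reindexing legitimate; the derivative costs
  -- the factor `|k|` in the majorant.
  have hT : ∀ m, Summable (trilinearTerm a m) := fun m => by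
    have h1 := (hkb.mul_of_nonneg hb (fun k => mul_nonneg (waveNorm_nonneg k) (hb0 k)) hb0).mul_left
      (3 * B)
    refine Summable.of_norm_bounded h1 fun p => ?_
    have h2 : ‖∑ j, Complex.I * (p.1 j : ℂ) * a (p.1 - p.2) j‖ ≤ 3 * (waveNorm p.1 * B) := by
      refine (norm_sum_le_of_le (f := fun j => Complex.I * (p.1 j : ℂ) * a (p.1 - p.2) j)
        Finset.univ (n := fun _ => waveNorm p.1 * B) fun j _ => ?_).trans (by simp)
      rw [norm_mul, norm_mul, Complex.norm_I, one_mul]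
      refine mul_le_mul ?_ (hB _ j) (norm_nonneg _) (waveNorm_nonneg _)
      simpa using abs_le_waveNorm p.1 j
    rw [trilinearTerm, norm_mul, norm_mul, RCLike.norm_conj]
    calc _ ≤ b p.1 * b p.2 * (3 * (waveNorm p.1 * B)) := by
          refine mul_le_mul (mul_le_mul (hab _ _) (hab _ _) (norm_nonneg _) (hb0 _)) h2
            (norm_nonneg _) (mul_nonneg (hb0 _) (hb0 _))
      _ = _ := by ring
  -- The map `(k,l) ↦ (-l,-k)`, under which the summand is odd, so its sum equals its own negative.
  let e : (Fin 3 → ℤ) × (Fin 3 → ℤ) ≃ (Fin 3 → ℤ) × (Fin 3 → ℤ) :=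
    (Equiv.prodComm _ _).trans (Equiv.neg _)
  have hzero : ∀ m, HasSum (trilinearTerm a m) 0 := fun m => by
    have h1 := (e.tsum_eq (trilinearTerm a m))
    have h2 : ∀ p, trilinearTerm a m (e p) = -trilinearTerm a m p := fun p =>
      ha.trilinearTerm_swap m p.1 p.2
    simp only [h2, tsum_neg] at h1
    have h3 : ∑' p, trilinearTerm a m p = 0 := self_eq_neg.1 h1.symm
    rw [← h3]
    exact (hT m).hasSum
  have hsum : HasSum (fun p => ∑ m, trilinearTerm a m p) 0 := by
    simpa using hasSum_sum fun m (_ : m ∈ Finset.univ) => hzero m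
  refine hsum.prod_fiberwise fun k => ?_
  have hconv : ∀ j m, HasSum (fun l => a (k - l) j * a l m) (convCoeff a j m k) := fun j m => by
    refine Summable.hasSum (Summable.of_norm_bounded (hb.mul_left B) fun l => ?_)
    rw [norm_mul]
    exact mul_le_mul (hB _ _) (hab _ _) (norm_nonneg _) hB0
  have hfib : ∀ m, HasSum (fun l => trilinearTerm a m (k, l))
      (starRingEnd ℂ (a k m) * ∑ j, Complex.I * (k j : ℂ) * convCoeff a j m k) := fun m => by
    have h1 := (hasSum_sum fun j (_ : j ∈ Finset.univ) =>
      (hconv j m).mul_left (Complex.I * (k j : ℂ))).mul_left (starRingEnd ℂ (a k m))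
    refine h1.congr_fun fun l => ?_
    simp only [trilinearTerm, Finset.mul_sum]
    refine Finset.sum_congr rfl fun j _ => ?_
    ring
  have h4 := hasSum_sum fun m (_ : m ∈ Finset.univ) => hfib m
  have h5 : ∑ i, starRingEnd ℂ (a k i) * nonlin a k i
      = ∑ m, starRingEnd ℂ (a k m) * ∑ j, Complex.I * (k j : ℂ) * convCoeff a j m k := by
    have hcomm : ∀ (c S : Fin 3 → ℂ) (M : Fin 3 → Fin 3 → ℂ),
        ∑ i, c i * ∑ m, M i m * S m = ∑ m, (∑ i, c i * M i m) * S m := fun c S M => by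
      simp only [Finset.mul_sum, Finset.sum_mul]
      rw [Finset.sum_comm]
      simp only [mul_assoc]
    refine (hcomm _ _ _).trans (Finset.sum_congr rfl fun m _ => ?_)
    rw [ha.sum_conj_mul_leray k m]
  rw [h5]
  exact h4

/-! ### Spectral solutions: smoothing and energy. -/

/-- The symbol of the dissipation operator `μ e^{2σ A^{1/2}}`. -/
def dissip (μ σ : ℝ) (k : Fin 3 → ℤ) : ℝ := μ * Real.exp (2 * σ * waveNorm k)

/-- Solutions of the Navier-Stokes equations with exponential dissipation in terms of Fourier
coefficients. -/
structure IsSpectralSolution (μ σ T : ℝ) (a : ℝ → (Fin 3 → ℤ) → Fin 3 → ℂ) : Prop where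
  spectrum : ∀ t ∈ Set.Icc 0 T, IsSpectrum (a t)
  bounded : ∃ M, ∀ t ∈ Set.Icc 0 T, HasExpBound 0 (a t) M
  mode : ∀ k i, IsModeSolution (dissip μ σ k) T (fun t => a t k i) (fun t => nonlin (a t) k i)

theorem dissip_pos {μ : ℝ} (hμ : 0 < μ) (σ : ℝ) (k : Fin 3 → ℤ) : 0 < dissip μ σ k :=
  mul_pos hμ (Real.exp_pos _)

theorem inv_dissip (μ σ : ℝ) (k : Fin 3 → ℤ) :
    (dissip μ σ k)⁻¹ = μ⁻¹ * Real.exp (-(2 * σ) * waveNorm k) := by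
  rw [dissip, mul_inv, ← Real.exp_neg]
  congr 2
  ring

theorem summable_waveNorm_pow_div_dissip (μ : ℝ) {σ : ℝ} (hσ : 0 < σ) (p : ℕ) :
    Summable fun k => waveNorm k ^ p * (dissip μ σ k)⁻¹ := by
  refine ((summable_waveNorm_pow_mul_exp (c := 2 * σ) (by positivity) p).mul_left μ⁻¹).congr
    fun k => ?_
  rw [inv_dissip]
  ring

namespace IsSpectralSolution

variable {μ σ T : ℝ} {a : ℝ → (Fin 3 → ℤ) → Fin 3 → ℂ}

theorem norm_le (h : IsSpectralSolution μ σ T a) (hμ : 0 < μ) {s t lam Y : ℝ} (hs : 0 ≤ s)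
    (hst : s ≤ t) (ht : t ≤ T) (hlam : 0 ≤ lam)
    (hY : ∀ r ∈ Set.Icc s t, HasExpBound lam (a r) Y) (k : Fin 3 → ℤ) (i : Fin 3) :
    ‖a t k i‖ ≤ Real.exp (-dissip μ σ k * (t - s)) * ‖a s k i‖ +
      18 * waveNorm k * (Real.exp (-lam * waveNorm k) * Y) / dissip μ σ k :=
  (h.mode k i).norm_le (dissip_pos hμ σ k) hs hst ht fun r hr => (hY r hr).norm_nonlin_le hlam k i

/-- Parabolic smoothing: one gains a factor `e^{σ|k|}` at the price of squaring the bound. -/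
theorem hasExpBound_add (h : IsSpectralSolution μ σ T a) (hμ : 0 < μ) (hσ : 0 < σ)
    {s t lam Y : ℝ} (hs : 0 ≤ s) (hst : s < t) (ht : t ≤ T) (hlam : 0 ≤ lam)
    (hY : ∀ r ∈ Set.Icc s t, HasExpBound lam (a r) Y) :
    HasExpBound (lam + σ) (a t) ((μ * (t - s))⁻¹ * Y +
      6 * (18 / μ) ^ 2 * (∑' k, waveNorm k ^ 2 * Real.exp (-(2 * σ) * waveNorm k)) * Y ^ 2) := by
  have h1 := (hY s ⟨le_rfl, hst.le⟩)
  have hS := (summable_waveNorm_pow_mul_exp (c := 2 * σ) (by positivity) 2).hasSum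
  have hts : 0 < t - s := sub_pos.2 hst
  have hg := (h1.summable.hasSum.mul_left (μ * (t - s))⁻¹).add
    ((hS.mul_left (6 * (18 / μ) ^ 2)).mul_right (Y ^ 2))
  refine (HasExpBound.of_le (fun k => ?_) hg).mono_right ?_
  · set w := waveNorm k
    set d := dissip μ σ k with hd
    have hdpos : 0 < d := dissip_pos hμ σ k
    have hw : 0 ≤ w := waveNorm_nonneg k
    have hE : Real.exp (2 * σ * w) = d / μ := by
      rw [hd, dissip]; field_simp; rfl
    -- From `e^{-x} ≤ 1/x`: the factor `1/d` gained here cancels the extra weight `e^{2σ|k|} = d/μ`.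
    have hexp : Real.exp (-d * (t - s)) ^ 2 ≤ (2 * (d * (t - s)))⁻¹ := by
      rw [← Real.exp_nat_mul]
      have h2 : ((2 : ℕ) : ℝ) * (-d * (t - s)) = -(2 * (d * (t - s))) := by push_cast; ring
      rw [h2, Real.exp_neg]
      refine inv_anti₀ (by positivity) ?_
      linarith [Real.add_one_le_exp (2 * (d * (t - s)))]
    -- By `(x + y)² ≤ 2x² + 2y²`; this 2 and the three components give the constant 6.
    have hmode : ∀ i, ‖a t k i‖ ^ 2 ≤ (d * (t - s))⁻¹ * ‖a s k i‖ ^ 2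
        + 2 * (18 * w * (Real.exp (-lam * w) * Y) / d) ^ 2 := fun i => by
      have h3 := h.norm_le hμ hs hst.le ht hlam hY k i
      have h4 : ‖a t k i‖ ^ 2 ≤ (Real.exp (-d * (t - s)) * ‖a s k i‖ +
          18 * w * (Real.exp (-lam * w) * Y) / d) ^ 2 :=
        pow_le_pow_left₀ (norm_nonneg _) h3 2
      have h6 := mul_le_mul_of_nonneg_right hexp (sq_nonneg ‖a s k i‖)
      have h7 : (2 * (d * (t - s)))⁻¹ * ‖a s k i‖ ^ 2 = (d * (t - s))⁻¹ * ‖a s k i‖ ^ 2 / 2 := by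
        field_simp
      rw [h7, ← mul_pow] at h6
      nlinarith [sq_nonneg (Real.exp (-d * (t - s)) * ‖a s k i‖ -
          18 * w * (Real.exp (-lam * w) * Y) / d)]
    have hsum : modeSq (a t) k ≤ (d * (t - s))⁻¹ * modeSq (a s) k
        + 6 * (18 * w * (Real.exp (-lam * w) * Y) / d) ^ 2 := by
      refine (Finset.sum_le_sum fun i _ => hmode i).trans (le_of_eq ?_)
      rw [Finset.sum_add_distrib, ← Finset.mul_sum, modeSq]
      simp only [Finset.sum_const, Finset.card_univ, Fintype.card_fin, nsmul_eq_mul]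
      push_cast
      ring
    -- In the nonlinear part `1/d²` meets the extra weight `d/μ`, so a summable `1/d`, that is
    -- `e^{-2σ|k|}`, remains.
    have hsplit : Real.exp (2 * (lam + σ) * w) = Real.exp (2 * lam * w) * (d / μ) := by
      rw [← hE, ← Real.exp_add]; congr 1; ring
    have hd2 : Real.exp (-(2 * σ) * w) = μ / d := by
      rw [← inv_div, ← hE, ← Real.exp_neg]; congr 1; ring
    have hlam2 : Real.exp (2 * lam * w) * Real.exp (-lam * w) ^ 2 = 1 := by
      rw [← Real.exp_nat_mul, ← Real.exp_add]
      convert Real.exp_zero using 2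
      push_cast; ring
    rw [hsplit, hd2]
    calc Real.exp (2 * lam * w) * (d / μ) * modeSq (a t) k
        ≤ Real.exp (2 * lam * w) * (d / μ) * ((d * (t - s))⁻¹ * modeSq (a s) k
          + 6 * (18 * w * (Real.exp (-lam * w) * Y) / d) ^ 2) := by gcongr
      _ = (μ * (t - s))⁻¹ * (Real.exp (2 * lam * w) * modeSq (a s) k)
          + (Real.exp (2 * lam * w) * Real.exp (-lam * w) ^ 2) *
            (6 * (18 / μ) ^ 2 * (w ^ 2 * (μ / d)) * Y ^ 2) := by field_simp
      _ = _ := by rw [hlam2, one_mul]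
  · have := h1.tsum_le
    gcongr

theorem norm_le_of_bounded (h : IsSpectralSolution μ σ T a) (hμ : 0 < μ) {M : ℝ}
    (hM : ∀ t ∈ Set.Icc 0 T, HasExpBound 0 (a t) M) {t : ℝ} (ht : t ∈ Set.Icc 0 T)
    (k : Fin 3 → ℤ) (i : Fin 3) :
    ‖a t k i‖ ≤ Real.exp (-dissip μ σ k * t) * (M + 1)
      + 18 * M * (waveNorm k * (dissip μ σ k)⁻¹) := by
  have h1 := h.norm_le hμ le_rfl ht.1 ht.2 le_rfl
    (fun r hr => hM r ⟨hr.1, hr.2.trans ht.2⟩) k i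
  have h2 := (hM 0 ⟨le_rfl, ht.1.trans ht.2⟩).norm_le k i
  simp only [sub_zero, neg_zero, zero_mul, Real.exp_zero, one_mul] at h1
  refine h1.trans (add_le_add (by gcongr) (le_of_eq ?_))
  rw [div_eq_mul_inv]
  ring

/-- The pointwise bound loses its decay in `k` as time tends to 0, but integrating `e^{-dr}`
restores a factor `1/d`. This allows the energy balance to start at time 0. -/
theorem integral_norm_le (h : IsSpectralSolution μ σ T a) (hμ : 0 < μ) {M : ℝ}
    (hM : ∀ t ∈ Set.Icc 0 T, HasExpBound 0 (a t) M) {t : ℝ} (ht : t ∈ Set.Icc 0 T)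
    (k : Fin 3 → ℤ) (i : Fin 3) :
    ∫ r in (0 : ℝ)..t, ‖a r k i‖ ≤ (M + 1) * (dissip μ σ k)⁻¹
      + 18 * M * t * (waveNorm k * (dissip μ σ k)⁻¹) := by
  have hd := dissip_pos hμ σ k
  have hM0 : 0 ≤ M := (hM 0 ⟨le_rfl, ht.1.trans ht.2⟩).nonneg
  have hc : ContinuousOn (fun r => ‖a r k i‖) (Set.uIcc 0 t) := by
    rw [Set.uIcc_of_le ht.1]
    exact ((h.mode k i).continuousOn.mono (Set.Icc_subset_Icc le_rfl ht.2)).norm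
  have hint : ∫ r in (0 : ℝ)..t, Real.exp (-dissip μ σ k * r) ≤ (dissip μ σ k)⁻¹ := by
    rw [intervalIntegral.integral_eq_sub_of_hasDerivAt
      (f := fun r => -(dissip μ σ k)⁻¹ * Real.exp (-dissip μ σ k * r))]
    · simp only [mul_zero, Real.exp_zero]
      have := mul_pos (inv_pos.2 hd) (Real.exp_pos (-dissip μ σ k * t))
      linarith
    · intro x _
      have h1 := (((hasDerivAt_id x).const_mul (-dissip μ σ k)).exp).const_mul
        (-(dissip μ σ k)⁻¹)
      refine h1.congr_deriv ?_
      simp only [id_eq]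
      field_simp
    · exact Continuous.intervalIntegrable (by fun_prop) _ _
  calc ∫ r in (0 : ℝ)..t, ‖a r k i‖
      ≤ ∫ r in (0 : ℝ)..t, (Real.exp (-dissip μ σ k * r) * (M + 1)
        + 18 * M * (waveNorm k * (dissip μ σ k)⁻¹)) := by
        refine intervalIntegral.integral_mono_on ht.1 hc.intervalIntegrable
          (Continuous.intervalIntegrable (by fun_prop) _ _) fun r hr => ?_
        exact h.norm_le_of_bounded hμ hM ⟨hr.1, hr.2.trans ht.2⟩ k i
    _ = (∫ r in (0 : ℝ)..t, Real.exp (-dissip μ σ k * r)) * (M + 1)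
        + 18 * M * t * (waveNorm k * (dissip μ σ k)⁻¹) := by
        rw [intervalIntegral.integral_add (Continuous.intervalIntegrable (by fun_prop) _ _)
          (Continuous.intervalIntegrable (by fun_prop) _ _), intervalIntegral.integral_mul_const,
          intervalIntegral.integral_const, smul_eq_mul]
        ring
    _ ≤ _ := by rw [mul_comm (M + 1)]; gcongr

/-- At positive times the nonlinear term does not contribute to the energy balance. -/
theorem hasSum_conj_mul_nonlin (h : IsSpectralSolution μ σ T a) (hμ : 0 < μ) (hσ : 0 < σ) {t : ℝ}
    (ht : t ∈ Set.Ioc 0 T) :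
    HasSum (fun k => ∑ i, starRingEnd ℂ (a t k i) * nonlin (a t) k i) 0 := by
  obtain ⟨M, hM⟩ := h.bounded
  have htI : t ∈ Set.Icc 0 T := ⟨ht.1.le, ht.2⟩
  have hM0 : 0 ≤ M := (hM t htI).nonneg
  have h0 := summable_waveNorm_pow_div_dissip μ hσ 0
  have h1 := summable_waveNorm_pow_div_dissip μ hσ 1
  have h2 := summable_waveNorm_pow_div_dissip μ hσ 2
  refine (h.spectrum t htI).hasSum_conj_mul_nonlin (hM t htI).norm_le
    (b := fun k => (dissip μ σ k)⁻¹ * ((M + 1) / t)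
      + 18 * M * (waveNorm k * (dissip μ σ k)⁻¹)) (fun k i => ?_) ?_ ?_
  · refine (h.norm_le_of_bounded hμ hM htI k i).trans (add_le_add ?_ le_rfl)
    have hd := dissip_pos hμ σ k
    have h3 : Real.exp (-dissip μ σ k * t) ≤ (dissip μ σ k * t)⁻¹ := by
      rw [neg_mul, Real.exp_neg]
      refine inv_anti₀ (mul_pos hd ht.1) ?_
      linarith [Real.add_one_le_exp (dissip μ σ k * t)]
    calc _ ≤ (dissip μ σ k * t)⁻¹ * (M + 1) := by gcongr
      _ = _ := by rw [mul_inv]; ring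
  · refine ((h0.mul_right ((M + 1) / t)).add (h1.mul_left (18 * M))).congr fun k => ?_
    simp
  · refine ((h1.mul_right ((M + 1) / t)).add (h2.mul_left (18 * M))).congr fun k => ?_
    ring

/-- The energy inequality. -/
theorem hasExpBound_zero (h : IsSpectralSolution μ σ T a) (hμ : 0 < μ) (hσ : 0 < σ) {E t : ℝ}
    (hE : HasExpBound 0 (a 0) E) (ht : t ∈ Set.Icc 0 T) : HasExpBound 0 (a t) E := by
  obtain ⟨M, hM⟩ := h.bounded
  have h0T : (0 : ℝ) ∈ Set.Icc 0 T := ⟨le_rfl, ht.1.trans ht.2⟩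
  have hM0 : 0 ≤ M := (hM t ht).nonneg
  have hc : ∀ k i, ContinuousOn (fun r => a r k i) (Set.uIcc 0 t) := fun k i => by
    rw [Set.uIcc_of_le ht.1]
    exact (h.mode k i).continuousOn.mono (Set.Icc_subset_Icc le_rfl ht.2)
  have hN : ∀ k i, IntervalIntegrable (fun r => nonlin (a r) k i) volume 0 t := fun k i => by
    refine (h.mode k i).integrable.mono_set ?_
    rw [Set.uIcc_of_le ht.1, Set.uIcc_of_le h0T.2]
    exact Set.Icc_subset_Icc le_rfl ht.2
  have hi : ∀ k i, IntervalIntegrable (fun r => starRingEnd ℂ (a r k i) * nonlin (a r) k i)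
      volume 0 t := fun k i =>
    (hN k i).continuousOn_mul (Complex.continuous_conj.comp_continuousOn (hc k i))
  have hisum : ∀ k, IntervalIntegrable (fun r => ∑ i, starRingEnd ℂ (a r k i) * nonlin (a r) k i)
      volume 0 t := fun k => by
    refine (IntervalIntegrable.sum Finset.univ fun i _ => hi k i).congr fun r _ => ?_
    simp
  have hexpand : ∀ r k i, (starRingEnd ℂ (a r k i) *
      ((dissip μ σ k : ℂ) * a r k i + nonlin (a r) k i)).re
      = dissip μ σ k * ‖a r k i‖ ^ 2 + (starRingEnd ℂ (a r k i) * nonlin (a r) k i).re :=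
    fun r k i => by
      rw [mul_add, Complex.add_re, mul_left_comm, Complex.re_ofReal_mul,
        mul_comm (starRingEnd ℂ (a r k i)) (a r k i), Complex.mul_conj,
        Complex.normSq_eq_norm_sq, Complex.ofReal_re]
  -- Energy balance of one mode, with the nonnegative dissipation discarded.
  have hmode : ∀ k, modeSq (a t) k ≤ modeSq (a 0) k -
      2 * (∫ r in (0 : ℝ)..t, ∑ i, starRingEnd ℂ (a r k i) * nonlin (a r) k i).re := fun k => by
    have h1 : ∀ i, ‖a t k i‖ ^ 2 ≤ ‖a 0 k i‖ ^ 2 -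
        2 * (∫ r in (0 : ℝ)..t, starRingEnd ℂ (a r k i) * nonlin (a r) k i).re := fun i => by
      have h2 := (h.mode k i).norm_sq_eq le_rfl ht.1 ht.2
      rw [h2]
      have h3 : (∫ r in (0 : ℝ)..t, starRingEnd ℂ (a r k i) * nonlin (a r) k i).re
          = ∫ r in (0 : ℝ)..t, (starRingEnd ℂ (a r k i) * nonlin (a r) k i).re := by
        rw [intervalIntegral.integral_of_le ht.1, intervalIntegral.integral_of_le ht.1]
        exact (integral_re (𝕜 := ℂ) (hi k i).1).symm
      have hre : IntervalIntegrable (fun r => (starRingEnd ℂ (a r k i) * nonlin (a r) k i).re)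
        volume 0 t := ⟨(hi k i).1.re, (hi k i).2.re⟩
      rw [h3, ← intervalIntegral.integral_const_mul]
      refine sub_le_sub_left (intervalIntegral.integral_mono_on ht.1 (hre.const_mul 2) ?_ ?_) _
      · have h4 : IntervalIntegrable (fun r => ‖a r k i‖ ^ 2) volume 0 t :=
          ((hc k i).norm.pow 2).intervalIntegrable
        refine ((h4.const_mul (2 * dissip μ σ k)).add (hre.const_mul 2)).congr fun r _ => ?_
        simp only [hexpand]
        ring
      · intro r _
        have hd := dissip_pos hμ σ k
        simp only [hexpand]
        nlinarith [mul_nonneg hd.le (sq_nonneg ‖a r k i‖)]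
    rw [intervalIntegral.integral_finsetSum fun i _ => hi k i, Complex.re_sum, Finset.mul_sum,
      modeSq, modeSq, ← Finset.sum_sub_distrib]
    exact Finset.sum_le_sum fun i _ => h1 i
  -- The sum over `k` and the time integral are exchanged; at each `r > 0` the summed integrand
  -- vanishes. The majorant comes from `integral_norm_le`, with `54 = 3 · 18`.
  have hsum : HasSum (fun k => ∫ r in (0 : ℝ)..t,
      ∑ i, starRingEnd ℂ (a r k i) * nonlin (a r) k i) 0 := by
    simp only [intervalIntegral.integral_of_le ht.1]
    have h1 := summable_waveNorm_pow_div_dissip μ hσ 1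
    have h2 := summable_waveNorm_pow_div_dissip μ hσ 2
    have hbound : ∀ k, ∫ r in Set.Ioc 0 t, ‖∑ i, starRingEnd ℂ (a r k i) * nonlin (a r) k i‖
        ≤ 54 * M * (M + 1) * (waveNorm k ^ 1 * (dissip μ σ k)⁻¹)
          + 54 * M * (18 * M * t) * (waveNorm k ^ 2 * (dissip μ σ k)⁻¹) := fun k => by
      have hw := waveNorm_nonneg k
      rw [← intervalIntegral.integral_of_le ht.1]
      have hnc : ∀ i, IntervalIntegrable (fun r => ‖a r k i‖) volume 0 t := fun i =>
        (hc k i).norm.intervalIntegrable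
      have hle : ∫ r in (0 : ℝ)..t, ‖∑ i, starRingEnd ℂ (a r k i) * nonlin (a r) k i‖
          ≤ ∫ r in (0 : ℝ)..t, ∑ i, 18 * waveNorm k * M * ‖a r k i‖ := by
        refine intervalIntegral.integral_mono_on ht.1 (hisum k).norm ?_ fun r hr => ?_
        · refine (IntervalIntegrable.sum Finset.univ fun i _ =>
            (hnc i).const_mul (18 * waveNorm k * M)).congr fun r _ => ?_
          simp
        · refine norm_sum_le_of_le _ fun i _ => ?_
          rw [norm_mul, RCLike.norm_conj, mul_comm]
          refine mul_le_mul_of_nonneg_right ?_ (norm_nonneg _)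
          have := (hM r ⟨hr.1, hr.2.trans ht.2⟩).norm_nonlin_le le_rfl k i
          simpa [mul_assoc] using this
      rw [intervalIntegral.integral_finsetSum fun i _ => (hnc i).const_mul _] at hle
      simp only [intervalIntegral.integral_const_mul] at hle
      refine hle.trans ((Finset.sum_le_sum fun i _ => mul_le_mul_of_nonneg_left
        (h.integral_norm_le hμ hM ht k i) (by positivity)).trans (le_of_eq ?_))
      simp only [Finset.sum_const, Finset.card_univ, Fintype.card_fin, nsmul_eq_mul]
      push_cast
      ring
    have hs := hasSum_integral_of_summable_integral_norm (μ := volume.restrict (Set.Ioc 0 t))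
      (F := fun k r => ∑ i, starRingEnd ℂ (a r k i) * nonlin (a r) k i) (fun k => (hisum k).1)
      (Summable.of_nonneg_of_le (fun k => integral_nonneg fun _ => norm_nonneg _) hbound
        ((h1.mul_left _).add (h2.mul_left _)))
    have h0 : ∫ r in Set.Ioc 0 t, ∑' k, ∑ i, starRingEnd ℂ (a r k i) * nonlin (a r) k i = 0 := by
      rw [← integral_zero ℝ ℂ (μ := volume.restrict (Set.Ioc 0 t))]
      refine setIntegral_congr_fun measurableSet_Ioc fun r hr => ?_
      exact (h.hasSum_conj_mul_nonlin hμ hσ ⟨hr.1, hr.2.trans ht.2⟩).tsum_eq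
    rw [h0] at hs
    exact hs
  have hfin := hE.summable.hasSum.sub ((Complex.hasSum_re hsum).mul_left 2)
  refine (HasExpBound.of_le (fun k => ?_) hfin).mono_right ?_
  · simpa using hmode k
  · simpa using hE.tsum_le

end IsSpectralSolution

/-! ### Iteration of the smoothing estimate. -/

/-- Iterated parabolic smoothing: super-exponential growth of the Gevrey bounds. -/
theorem IsSpectralSolution.exists_hasExpBound {μ σ L U E η c : ℝ} (hμ : 0 < μ) (hσ : 0 < σ)
    (hL : 0 < L) (hU : 0 < U) (hη : 0 < η) (hc : 2 < c) :
    ∃ Λ : ℝ, 0 < Λ ∧ ∀ (T : ℝ) (a : ℝ → (Fin 3 → ℤ) → Fin 3 → ℂ), T < L / U →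
      IsSpectralSolution μ σ T a → HasExpBound 0 (a 0) E → ∀ n : ℕ, ∀ t ∈ Set.Ioc 0 T,
        HasExpBound ((n + 1) * σ) (a t) (η * (Λ * L / (U * t)) ^ (c ^ n)) := by
  set D := 6 * (18 / μ) ^ 2 * ∑' k, waveNorm k ^ 2 * Real.exp (-(2 * σ) * waveNorm k) with hD
  have hD0 : 0 ≤ D := mul_nonneg (by positivity)
    (tsum_nonneg fun k => mul_nonneg (sq_nonneg _) (Real.exp_pos _).le)
  -- Smoothing from `t/2` to `t` turns a bound `η V` into at most `G V²`, once `L/(Ut) ≤ V`. The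
  -- truncation `Q ≥ 1` gives `Q ≤ Q^p` later.
  set G := 2 * U * η / (μ * L) + D * η ^ 2 with hG
  set Q := max (G / η) 1 with hQ
  have hQ1 : 1 ≤ Q := le_max_right _ _
  have hGQ : G ≤ η * Q := by
    have := le_max_left (G / η) 1
    rwa [← hQ, div_le_iff₀' hη] at this
  -- The second entry settles the first level, the third gives `4Q ≤ Λ^(c-2)` for the induction
  -- step.
  set Λ := max 1 (max ((2 * U * E / (μ * L) + D * E ^ 2) / η) ((4 * Q) ^ (1 / (c - 2)))) with hΛ
  have hΛ1 : 1 ≤ Λ := le_max_left _ _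
  have hΛ2 : 2 * U * E / (μ * L) + D * E ^ 2 ≤ η * Λ := by
    rw [← div_le_iff₀' hη]
    exact (le_max_left _ _).trans (le_max_right _ _)
  have hΛ3 : 4 * Q ≤ Λ ^ (c - 2) := by
    have h1 : (4 * Q) ^ (1 / (c - 2)) ≤ Λ := (le_max_right _ _).trans (le_max_right _ _)
    have h2 := Real.rpow_le_rpow (by positivity) h1 (sub_pos.2 hc).le
    rwa [← Real.rpow_mul (by positivity), one_div_mul_cancel (sub_pos.2 hc).ne',
      Real.rpow_one] at h2
  refine ⟨Λ, zero_lt_one.trans_le hΛ1, fun T a hT ha hE n => ?_⟩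
  -- Here `T < L/U` enters: lower powers of `L/(Ut)` are dominated by higher ones.
  have hx : ∀ t ∈ Set.Ioc 0 T, 1 ≤ L / (U * t) := fun t ht => by
    rw [one_le_div (mul_pos hU ht.1)]
    have := ht.2.trans hT.le
    rwa [le_div_iff₀' hU] at this
  have hinv : ∀ t ∈ Set.Ioc 0 T, (μ * (t - t / 2))⁻¹ = 2 * U / (μ * L) * (L / (U * t)) :=
    fun t ht => by
      have := ht.1.ne'
      field_simp
      ring
  induction n with
  | zero =>
    intro t ht
    have hhalf : (0 : ℝ) ≤ t / 2 := (half_pos ht.1).le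
    have h1 := ha.hasExpBound_add hμ hσ hhalf (half_lt_self ht.1) ht.2 le_rfl
      fun r hr => ha.hasExpBound_zero hμ hσ hE ⟨hhalf.trans hr.1, hr.2.trans ht.2⟩
    simp only [Nat.cast_zero, zero_add, one_mul, pow_zero, Real.rpow_one] at h1 ⊢
    refine h1.mono_right ?_
    rw [← hD, hinv t ht]
    have hx1 := hx t ht
    have hE0 := hE.nonneg
    calc _ = 2 * U * E / (μ * L) * (L / (U * t)) + D * E ^ 2 * 1 := by ring
      _ ≤ 2 * U * E / (μ * L) * (L / (U * t)) + D * E ^ 2 * (L / (U * t)) := by gcongr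
      _ = (2 * U * E / (μ * L) + D * E ^ 2) * (L / (U * t)) := by ring
      _ ≤ η * Λ * (L / (U * t)) := by gcongr
      _ = _ := by ring
  | succ n ih =>
    intro t ht
    have hhalf : (0 : ℝ) < t / 2 := half_pos ht.1
    have hx1 := hx t ht
    set x := L / (U * t) with hxdef
    have hZ : Λ * L / (U * t) = Λ * x := by rw [hxdef, mul_div_assoc]
    set Z := Λ * x with hZdef
    have hxZ : x ≤ Z := le_mul_of_one_le_left (by linarith) hΛ1
    have hΛZ : Λ ≤ Z := le_mul_of_one_le_right (by linarith) hx1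
    have hZ1 : 1 ≤ Z := hΛ1.trans hΛZ
    have hZ0 : 0 < Z := by linarith
    set p := c ^ n with hp
    have hp1 : 1 ≤ p := one_le_pow₀ (by linarith)
    -- On `[t/2, t]` the induction hypothesis holds with `Z` replaced by at most `2Z`; squaring `2Z`
    -- produces the 4 in `4Q`.
    have h1 := ha.hasExpBound_add hμ hσ hhalf.le (half_lt_self ht.1) ht.2
      (lam := (n + 1) * σ) (Y := η * (2 * Z) ^ p) (by positivity) fun r hr => by
        have hr0 : 0 < r := hhalf.trans_le hr.1
        refine (ih r ⟨hr0, hr.2.trans ht.2⟩).mono_right ?_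
        refine mul_le_mul_of_nonneg_left (Real.rpow_le_rpow (by positivity) ?_ (by linarith)) hη.le
        rw [← hZ, div_le_iff₀ (by positivity)]
        have h2 : 2 * (Λ * L / (U * t)) * (U * r) = Λ * L * (2 * r / t) := by
          have := ht.1.ne'
          field_simp
        rw [h2]
        refine le_mul_of_one_le_right (by positivity) ?_
        rw [one_le_div ht.1]
        linarith [hr.1]
    have h2 : ((n + 1 : ℕ) + 1 : ℝ) * σ = (n + 1) * σ + σ := by push_cast; ring
    rw [h2, hZ]
    refine h1.mono_right ?_
    rw [← hD, hinv t ht, ← hxdef]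
    set V := (2 * Z) ^ p with hV
    have hxV : x ≤ V := by
      have h3 := Real.rpow_le_rpow_of_exponent_le (x := 2 * Z) (by linarith) hp1
      rw [Real.rpow_one] at h3
      linarith
    have hV0 : 0 ≤ V := by positivity
    -- The surplus `c - 2 > 0` in the exponent absorbs all constants, uniformly in `n`.
    have hZc : 4 * Q * Z ^ 2 ≤ Z ^ c := by
      have h3 : Z ^ c = Z ^ (c - 2) * Z ^ 2 := by
        rw [← Real.rpow_natCast, ← Real.rpow_add hZ0]
        congr 1
        push_cast; ring
      rw [h3]
      exact mul_le_mul_of_nonneg_right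
        (hΛ3.trans (Real.rpow_le_rpow (by linarith) hΛZ (by linarith))) (sq_nonneg _)
    have hQp : Q ≤ Q ^ p := by
      simpa using Real.rpow_le_rpow_of_exponent_le hQ1 hp1
    have hV2 : V ^ 2 = (4 * Z ^ 2) ^ p := by
      rw [hV, sq, ← Real.mul_rpow (by positivity) (by positivity)]
      congr 1
      ring
    calc 2 * U / (μ * L) * x * (η * V) + D * (η * V) ^ 2
        ≤ 2 * U / (μ * L) * V * (η * V) + D * (η * V) ^ 2 := by gcongr
      _ = G * V ^ 2 := by rw [hG]; ring
      _ ≤ η * Q ^ p * V ^ 2 := by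
          refine mul_le_mul_of_nonneg_right (hGQ.trans ?_) (sq_nonneg _)
          gcongr
      _ = η * (4 * Q * Z ^ 2) ^ p := by
          rw [hV2, mul_assoc, ← Real.mul_rpow (by positivity) (by positivity)]
          congr 2
          ring
      _ ≤ η * (Z ^ c) ^ p := by gcongr
      _ = η * Z ^ (c ^ (n + 1)) := by
          rw [← Real.rpow_mul hZ0.le, hp, pow_succ']

/-! ### From vector fields to Fourier coefficients. -/

theorem MemH.component {φ : Field} (h : MemH φ) (i : Fin 3) :
    MemLp (fun x => φ x i) 2 volume :=
  (EuclideanSpace.proj i : EuclideanSpace ℝ (Fin 3) →L[ℝ] ℝ).comp_memLp' h.memLp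

theorem MemH.isSpectrum {φ : Field} (h : MemH φ) : IsSpectrum (coeff φ) where
  conj_symm k i := scalarCoeff_neg _ k
  zero i := by
    have h1 := (EuclideanSpace.proj i : EuclideanSpace ℝ (Fin 3) →L[ℝ] ℝ).integral_comp_comm
      (h.memLp.integrable one_le_two)
    rw [h.mean_zero, map_zero] at h1
    have h2 : ∫ x, ((φ x i : ℝ) : ℂ) = 0 := by
      refine (integral_ofReal (𝕜 := ℂ)).trans ?_
      exact (congrArg Complex.ofReal h1).trans Complex.ofReal_zero
    simp [coeff, scalarCoeff, h2]
  div_free := h.div_free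

theorem MemH.nonlinCoeff_eq {φ : Field} (h : MemH φ) (k : Fin 3 → ℤ) (i : Fin 3) :
    nonlinCoeff φ k i = nonlin (coeff φ) k i := by
  refine Finset.sum_congr rfl fun m _ => ?_
  refine congrArg₂ _ rfl (Finset.sum_congr rfl fun j _ => ?_)
  rw [← (hasSum_scalarCoeff_mul (h.component j) (h.component m) k).tsum_eq]
  rfl

/-- Parseval, summed over components. The `max R 0` matches the truncation in `ENNReal.ofReal`. -/
theorem MemH.hasExpBound {φ : Field} (h : MemH φ) {R : ℝ}
    (hR : eLpNorm φ 2 volume ≤ ENNReal.ofReal R) :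
    HasExpBound 0 (coeff φ) (((2 * Real.pi) ^ 3)⁻¹ * (max R 0) ^ 2) := by
  have h1 := hasSum_sum fun i (_ : i ∈ Finset.univ) => hasSum_sq_scalarCoeff (h.component i)
  refine (HasExpBound.of_le (fun k => ?_) h1).mono_right ?_
  · simp [modeSq, coeff]
  · rw [← Finset.mul_sum]
    refine mul_le_mul_of_nonneg_left ?_ (by positivity)
    rw [← integral_finsetSum _ fun i _ => (h.component i).integrable_sq]
    have h2 : ∫ x, ∑ i, φ x i ^ 2 = ∫ x, ‖φ x‖ ^ (2 : ENNReal).toReal := by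
      refine integral_congr_ae (Filter.Eventually.of_forall fun x => ?_)
      simp [EuclideanSpace.norm_sq_eq]
    have hI : 0 ≤ ∫ x, ‖φ x‖ ^ (2 : ENNReal).toReal := integral_nonneg fun x => by positivity
    rw [h2]
    rw [h.memLp.eLpNorm_eq_integral_rpow_norm two_ne_zero ENNReal.ofNat_ne_top] at hR
    set J := ∫ x, ‖φ x‖ ^ (2 : ENNReal).toReal
    have h3 : J ^ (2 : ENNReal).toReal⁻¹ ≤ max R 0 := by
      rcases le_total R 0 with hR0 | hR0
      · rw [ENNReal.ofReal_of_nonpos hR0, nonpos_iff_eq_zero, ENNReal.ofReal_eq_zero] at hR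
        exact hR.trans (le_max_right _ _)
      · exact ((ENNReal.ofReal_le_ofReal_iff hR0).1 hR).trans (le_max_left _ _)
    have h4 : J = (J ^ (2 : ENNReal).toReal⁻¹) ^ 2 := by
      rw [← Real.rpow_natCast, ← Real.rpow_mul hI]
      simp
    rw [h4]
    exact pow_le_pow_left₀ (by positivity) h3 2

theorem HasExpBound.expNormSq_le {φ : Field} {lam Y : ℝ} (h : HasExpBound lam (coeff φ) Y) :
    expNormSq lam φ ≤ ENNReal.ofReal ((2 * Real.pi) ^ 3 * Y) := by
  rw [ENNReal.ofReal_mul (by positivity), expNormSq]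
  refine mul_le_mul_right ?_ _
  refine le_trans (le_of_eq ?_) (ENNReal.ofReal_le_ofReal h.tsum_le)
  exact (ENNReal.ofReal_tsum_of_nonneg (weighted_nonneg lam (coeff φ)) h.summable).symm

theorem IsSolution.isSpectralSolution {μ σ T : ℝ} (hT : 0 < T) {u₀ : Field} {u : ℝ → Field}
    (h : IsSolution μ σ T u₀ u) :
    IsSpectralSolution μ σ T (fun t => coeff (u t)) := by
  obtain ⟨M, hM⟩ := h.bounded
  have hbound : ∀ t ∈ Set.Icc 0 T, HasExpBound 0 (coeff (u t))
      (((2 * Real.pi) ^ 3)⁻¹ * (max M 0) ^ 2) := fun t ht => (h.memH t ht).hasExpBound (hM t ht)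
  refine ⟨fun t ht => (h.memH t ht).isSpectrum, ⟨_, hbound⟩, fun k i =>
    ⟨h.continuous_coeff k i, ?_, fun t ht => ?_⟩⟩
  · have hsub : Set.Ioc 0 T ⊆ Set.Icc 0 T := Set.Ioc_subset_Icc_self
    have hcoeff : ∀ k i, AEStronglyMeasurable (fun t => coeff (u t) k i)
        (volume.restrict (Set.Ioc 0 T)) := fun k i =>
      ((h.continuous_coeff k i).mono hsub).aestronglyMeasurable measurableSet_Ioc
    -- Measurability in time: the convolution is a pointwise limit of finite sums of products of
    -- continuous coefficients.
    have hconv : ∀ j m, AEStronglyMeasurable (fun t => convCoeff (coeff (u t)) j m k)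
        (volume.restrict (Set.Ioc 0 T)) := fun j m => by
      refine aestronglyMeasurable_of_tendsto_ae Filter.atTop
        (f := fun (s : Finset (Fin 3 → ℤ)) t => ∑ l ∈ s, coeff (u t) (k - l) j * coeff (u t) l m)
        (fun s => Finset.aestronglyMeasurable_fun_sum s fun l _ =>
          (hcoeff (k - l) j).mul (hcoeff l m)) ?_
      filter_upwards [ae_restrict_mem measurableSet_Ioc] with t ht
      have hmem := h.memH t (hsub ht)
      exact (hasSum_scalarCoeff_mul (hmem.component j) (hmem.component m) k).summable.hasSum
    have hmeas : AEStronglyMeasurable (fun t => nonlin (coeff (u t)) k i)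
        (volume.restrict (Set.Ioc 0 T)) :=
      Finset.aestronglyMeasurable_fun_sum _ fun m _ => aestronglyMeasurable_const.mul
        (Finset.aestronglyMeasurable_fun_sum _ fun j _ =>
          aestronglyMeasurable_const.mul (hconv j m))
    rw [intervalIntegrable_iff_integrableOn_Ioc_of_le hT.le]
    refine Integrable.of_bound hmeas (18 * waveNorm k * (Real.exp (-0 * waveNorm k) *
      (((2 * Real.pi) ^ 3)⁻¹ * (max M 0) ^ 2))) ?_
    filter_upwards [ae_restrict_mem measurableSet_Ioc] with t ht
    exact (hbound t (hsub ht)).norm_nonlin_le le_rfl k i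
  · have hinit : coeff (u 0) k i = coeff u₀ k i := by
      unfold coeff scalarCoeff
      congr 1
      refine integral_congr_ae ?_
      filter_upwards [h.initial] with x hx
      rw [hx]
    have heq : ∀ s ∈ Set.Icc 0 T, nonlinCoeff (u s) k i = nonlin (coeff (u s)) k i :=
      fun s hs => (h.memH s hs).nonlinCoeff_eq k i
    -- The zero mode is not covered by the equation, but there both the coefficient and the
    -- nonlinear term vanish.
    by_cases hk : k = 0
    · have hz : ∀ s ∈ Set.Icc 0 T, coeff (u s) k i = 0 := fun s hs => by
        rw [hk]; exact (h.memH s hs).isSpectrum.zero i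
      rw [hz t ht, hz 0 ⟨le_rfl, hT.le⟩, intervalIntegral.integral_congr (g := fun _ => 0)]
      · simp
      · intro s hs
        rw [Set.uIcc_of_le ht.1] at hs
        have h0 : nonlin (coeff (u s)) k i = 0 := by simp [nonlin, hk]
        simp only [hz s ⟨hs.1, hs.2.trans ht.2⟩, h0, mul_zero, add_zero]
    · rw [h.equation k hk i t ht, hinit]
      congr 1
      refine intervalIntegral.integral_congr fun s hs => ?_
      rw [Set.uIcc_of_le ht.1] at hs
      simp only [heq s ⟨hs.1, hs.2.trans ht.2⟩, dissip]

/-- The ratio equals `2 + 5/(2κ - 5)`. -/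
theorem two_lt_expo_base {κ δ : ℝ} (hκ : 3 < κ) (hδ : 0 < δ) :
    2 < (1 + δ) * ((4 * κ - 5) / (2 * κ - 5)) := by
  have h1 : 2 < (4 * κ - 5) / (2 * κ - 5) := by
    rw [lt_div_iff₀ (by linarith)]
    linarith
  nlinarith

end

end ExpNSE


/-! ### The theorem. -/

theorem theorem3p1 (μ σ L U : ℝ) (hμ : 0 < μ) (hσ : 0 < σ) (hL : 0 < L) (hU : 0 < U)
    (R κ δ : ℝ) (hκ : 3 < κ) (hδ : 0 < δ) :
    ∃ Λ : ℝ, 0 < Λ ∧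
      ∀ (T : ℝ) (u₀ : ExpNSE.Field) (u : ℝ → ExpNSE.Field), 0 < T → T < L / U →
        ExpNSE.MemH u₀ → MeasureTheory.eLpNorm u₀ 2 MeasureTheory.volume ≤ ENNReal.ofReal R →
        ExpNSE.IsSolution μ σ T u₀ u →
        ∀ n : ℕ, ∀ t ∈ Set.Ioc 0 T,
          ExpNSE.expNormSq (n * σ) (u t) ≤
              ENNReal.ofReal ((Λ * L / (U * t)) ^ ExpNSE.expo κ δ n) ∧
          (∫⁻ s in Set.Icc t T, ExpNSE.expNormSq ((n + 1) * σ) (u s)) ≤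
              ENNReal.ofReal ((Λ * L / (U * t)) ^ ExpNSE.expo κ δ n) := by
  have hc := ExpNSE.two_lt_expo_base hκ hδ
  -- This `η` cancels the factor `(2π)³` from Parseval and leaves `U/L` to compensate for the length
  -- of the time interval.
  have hη : 0 < min 1 (U / L) / (2 * Real.pi) ^ 3 := by positivity
  obtain ⟨Λ, hΛ, H⟩ := ExpNSE.IsSpectralSolution.exists_hasExpBound
    (E := ((2 * Real.pi) ^ 3)⁻¹ * (max R 0) ^ 2) hμ hσ hL hU hη hc
  refine ⟨Λ, hΛ, fun T u₀ u hT hTL hu₀ hR hu n t ht => ?_⟩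
  have h0 : ExpNSE.HasExpBound 0 (ExpNSE.coeff (u 0)) (((2 * Real.pi) ^ 3)⁻¹ * (max R 0) ^ 2) :=
    (hu.memH 0 ⟨le_rfl, hT.le⟩).hasExpBound ((eLpNorm_congr_ae hu.initial).trans_le hR)
  have hB := H T _ hTL (hu.isSpectralSolution hT) h0 n
  have hcancel : ∀ W : ℝ, (2 * Real.pi) ^ 3 * (min 1 (U / L) / (2 * Real.pi) ^ 3 * W)
      = min 1 (U / L) * W := fun W => by field_simp
  have hUt : 0 < U * t := mul_pos hU ht.1
  refine ⟨?_, ?_⟩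
  · refine ((hB t ht).mono_left (lam' := n * σ) (by nlinarith)).expNormSq_le.trans
      (ENNReal.ofReal_le_ofReal ?_)
    rw [hcancel]
    exact mul_le_of_le_one_left (by positivity) (min_le_left _ _)
  · set W := (Λ * L / (U * t)) ^ ExpNSE.expo κ δ n with hW
    have hW0 : 0 ≤ W := by positivity
    -- The bound decreases in time, so its value at `t` serves on all of `[t,T]`.
    have hs : ∀ s ∈ Set.Icc t T, ExpNSE.expNormSq ((n + 1) * σ) (u s)
        ≤ ENNReal.ofReal (U / L * W) := fun s hs => by
      refine (hB s ⟨ht.1.trans_le hs.1, hs.2⟩).expNormSq_le.trans (ENNReal.ofReal_le_ofReal ?_)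
      rw [hcancel]
      refine mul_le_mul (min_le_right _ _) ?_ (by have := ht.1.trans_le hs.1; positivity)
        (by positivity)
      refine Real.rpow_le_rpow (by have := ht.1.trans_le hs.1; positivity) ?_ (by positivity)
      have := hs.1
      gcongr
    calc ∫⁻ s in Set.Icc t T, ExpNSE.expNormSq ((n + 1) * σ) (u s)
        ≤ ∫⁻ _ in Set.Icc t T, ENNReal.ofReal (U / L * W) :=
          setLIntegral_mono' measurableSet_Icc hs
      _ = ENNReal.ofReal (U / L * W * (T - t)) := by
          rw [setLIntegral_const, Real.volume_Icc, ← ENNReal.ofReal_mul (by positivity)]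
      _ ≤ ENNReal.ofReal W := by
          refine ENNReal.ofReal_le_ofReal ?_
          have h1 : U * (T - t) ≤ L := by
            rw [lt_div_iff₀' hU] at hTL
            linarith
          calc U / L * W * (T - t) = U * (T - t) / L * W := by ring
            _ ≤ 1 * W := by
              refine mul_le_mul_of_nonneg_right ?_ hW0
              rwa [div_le_one hL]
            _ = W := one_mul W
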